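/- Let $G$ be a finite group and $\Lambda=(V,E,F)$ a finite lattice (cell decomposition) with oriented edges on a closed oriented surface. Let $\mathcal H=\bigotimes_{e\in E}\mathbb C[G]$. For $v\in V$, $g\in G$ let $A_v(g)$ act on the group basis by $g_e\mapsto g\,g_e$ on edges $e$ pointing away from $v$ and $g_e\mapsto g_e g^{-1}$ on edges pointing to $v$. Put $A_v=|G|^{-1}\sum_g A_v(g)$, and let $B_p$ be the projector onto trivial holonomy around the plaquette $p$. A ground state is a unit vector $\psi\in\mathcal H$ with $A_v\psi=B_p\psi=\psi$ for all $v\in V$, $p\in F$. Let $A$ be a rectangular region, that is, the set of edges (including those on the boundary) of an embedded rectangular grid of $m\times n$ plaquettes, $m,n\ge1$, whose vertices lie in the interior of a larger embedded rectangular grid of $(m+2)\times(n+2)$ plaquettes of $\Lambda$. Let $v_1,\dots,v_L$ be the boundary vertices of $A$, and $\rho_A=\operatorname{Tr}_{\bar A}|\psi\rangle\langle\psi|$. Let $\hat G$ be a complete set of inequivalent irreducible complex representations of $G$, with dimensions $d_R$. Restricting the gauge transformation at $v_i$ to the edges in $A$ gives, for $i=1,\dots,L$, commuting actions of $G$ on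 $\mathcal H_A$, so that $$\mathcal H_A=\bigoplus_{\vec R\in\hat G^L}\mathcal V_{R_1}\otimes\cdots\otimes\mathcal V_{R_L}\otimes\mathcal W_{\vec R},\qquad \rho_A=\bigoplus_{\vec R}p_{\vec R}\,\frac{\mathbb 1}{d_{R_1}}\otimes\cdots\otimes\frac{\mathbb 1}{d_{R_L}}\otimes\rho_{\vec R},$$ where $p_{\vec R}$ are probabilities and $\rho_{\vec R}$ are states on the multiplicity spaces $\mathcal W_{\vec R}$. Let $S(\rho)=-\operatorname{Tr}\rho\log\rho$. The extended Hilbert space entropy is $S(\rho_A)$, the "$\log\dim R$ term" is $\sum_{\vec R}p_{\vec R}\sum_i\log d_{R_i}$, the distillable entropy is $S_{\rm dist}=\sum_{\vec R}p_{\vec R}S(\rho_{\vec R})$, and the algebraic entropy is $S_{\rm alg}=-\sum_{\vec R}p_{\vec R}\log p_{\vec R}+S_{\rm dist}$. Let $N_{\vec R}$ be the dimension of the space of $G$-invariants in $R_1\otimes\cdots\otimes R_L$, and $d_{\vec R}=\prod_i d_{R_i}$. **(1)** For every ground state and every rectangular region, $$S(\rho_A)=(L-1)\log|G|,\qquad \sum_{\vec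 R}p_{\vec R}\sum_{i=1}^L\log d_{R_i}=\frac{L}{|G|}\sum_{R\in\hat G}d_R^2\log d_R,$$ $$S_{\rm alg}=L\Big[\log|G|-\frac1{|G|}\sum_{R\in\hat G}d_R^2\log d_R\Big]-\log|G|,\qquad S_{\rm dist}=\frac1{|G|^{L-1}}\sum_{\vec R}N_{\vec R}\,d_{\vec R}\log N_{\vec R},$$ and $S_{\rm dist}=0$ if $G$ is Abelian. **(2)** For a family of such lattices, regions and ground states (with $G$ fixed) with $L\to\infty$, say that an entropy $S$ has topological entanglement entropy $S_{\rm topo}=-\gamma$ if $S=\alpha L-\gamma+o(1)$ with constants $\alpha,\gamma\ge0$. Then, for every such family, both the extended Hilbert space entropy and the algebraic entropy have topological entanglement entropy exactly $-\log|G|$ (and no other value). In general the distillable entropy does not: if $G$ is Abelian, its topological entanglement entropy is $0$, which is different from $-\log|G|$ when $G$ is nontrivial. -/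

import Mathlib

noncomputable section

namespace QuantumDouble

open Filter Topology

/-! ### Lattices on closed oriented surfaces -/

/-- A finite lattice (cell decomposition) on a closed oriented surface, with oriented edges.
A *dart* is an edge with a direction of travel: `(e, true)` runs along `e` from `src e` to `tgt e`,
`(e, false)` runs backwards. The surface is recorded by the permutation `next` of the darts, which
sends a dart to the following one on the counter-clockwise boundary of the plaquette on its left.
Plaquettes are the cycles of `next`. The last field says that the darts which leave a vertex form
one cyclic sequence, so that the surface is a disc around each vertex. -/
structure SurfaceLattice where
  /-- vertices -/
  V : Type
  /-- oriented edges -/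
  E : Type
  [fintypeV : Fintype V]
  [fintypeE : Fintype E]
  [decEqV : DecidableEq V]
  [decEqE : DecidableEq E]
  src : E → V
  tgt : E → V
  next : Equiv.Perm (E × Bool)
  next_start : ∀ d : E × Bool,
    (if (next d).2 then src (next d).1 else tgt (next d).1) = (if d.2 then tgt d.1 else src d.1)
  rotation_transitive : ∀ d d' : E × Bool,
    (if d.2 then src d.1 else tgt d.1) = (if d'.2 then src d'.1 else tgt d'.1) →
    ∃ k : ℕ, (fun c : E × Bool => next (c.1, !c.2))^[k] d = d'

attribute [instance] SurfaceLattice.fintypeV SurfaceLattice.fintypeE SurfaceLattice.decEqV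
  SurfaceLattice.decEqE

namespace SurfaceLattice

/-- Darts: edges with a direction of travel. -/
abbrev Dart (Λ : SurfaceLattice) : Type := Λ.E × Bool

variable (Λ : SurfaceLattice)

/-- The vertex at which a dart starts. -/
def start (d : Λ.Dart) : Λ.V := if d.2 then Λ.src d.1 else Λ.tgt d.1

/-- The vertex at which a dart ends. -/
def finish (d : Λ.Dart) : Λ.V := if d.2 then Λ.tgt d.1 else Λ.src d.1

/-- The same edge, travelled in the other direction. -/
def rev (d : Λ.Dart) : Λ.Dart := (d.1, !d.2)

end SurfaceLattice

/-! ### The quantum double model -/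

section Model

variable {G : Type*} [Group G] (Λ : SurfaceLattice)

/-- An assignment of group elements to the edges, i.e. a label of the group basis. -/
abbrev Config (G : Type*) (Λ : SurfaceLattice) : Type _ := Λ.E → G

/-- Vectors of `⨂_e ℂ[G]`, given by their coefficients in the group basis. -/
abbrev Ket (G : Type*) (Λ : SurfaceLattice) : Type _ := Config G Λ → ℂ

/-- The simultaneous gauge transformation by `h v` at all vertices `v`: an edge is multiplied by
`h v` on the left if it points away from `v`, and by `(h v)⁻¹` on the right if it points to `v`. -/
def gauge (h : Λ.V → G) (x : Config G Λ) : Config G Λ :=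
  fun e => h (Λ.src e) * x e * (h (Λ.tgt e))⁻¹

/-- The operator `A_v(g)`, which sends the basis vector of `x` to that of the transformed `x`. -/
def gaugeOp (v : Λ.V) (g : G) : Ket G Λ →ₗ[ℂ] Ket G Λ :=
  LinearMap.funLeft ℂ ℂ (gauge Λ (Pi.mulSingle v g⁻¹))

/-- The vertex projector `A_v = |G|⁻¹ ∑_g A_v(g)`. -/
def vertexOp [Fintype G] (v : Λ.V) : Ket G Λ →ₗ[ℂ] Ket G Λ :=
  (Fintype.card G : ℂ)⁻¹ • ∑ g : G, gaugeOp Λ v g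

/-- The group element read off along a dart. -/
def dartValue (x : Config G Λ) (d : Λ.Dart) : G := if d.2 then x d.1 else (x d.1)⁻¹

/-- The product of the group elements once around the plaquette to the left of `d`, starting at
the first vertex of `d`. -/
def holonomy (x : Config G Λ) (d : Λ.Dart) : G :=
  ((List.range (Function.minimalPeriod Λ.next d)).map
    (fun k => dartValue Λ x (Λ.next^[k] d))).prod

/-- The magnetic operator `B_{(v,p)}(h)` at the site whose plaquette `p` is on the left of `d` and
whose vertex `v` is the start of `d`. -/
def magneticOp [DecidableEq G] (d : Λ.Dart) (h : G) : Ket G Λ →ₗ[ℂ] Ket G Λ where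
  toFun ψ := fun x => if holonomy Λ x d = h then ψ x else 0
  map_add' ψ φ := by
    funext x
    by_cases hx : holonomy Λ x d = h <;> simp [hx]
  map_smul' c ψ := by
    funext x
    by_cases hx : holonomy Λ x d = h <;> simp [hx]

variable {Λ}

/-- Membership in the physical (gauge-invariant) Hilbert space: `A_v ψ = ψ` for all `v`. -/
def IsPhysical [Fintype G] (ψ : Ket G Λ) : Prop := ∀ v : Λ.V, vertexOp Λ v ψ = ψ

/-- Membership in the ground space of `H = ∑_v (1 - A_v) + ∑_p (1 - B_p)`:
`A_v ψ = ψ` and `B_p ψ = ψ` for all vertices `v` and plaquettes `p`. -/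
def IsGround [Fintype G] [DecidableEq G] (ψ : Ket G Λ) : Prop :=
  IsPhysical ψ ∧ ∀ d : Λ.Dart, magneticOp Λ d (1 : G) ψ = ψ

end Model

/-! ### Rectangular regions -/

/-- A rectangular region `A` of `m × n` plaquettes, together with a rectangle `B` of
`(m + 2) × (n + 2)` plaquettes which has the vertices of `A` in its interior. `B` is an
embedded piece of the square grid: `vert i j` for `0 ≤ i ≤ m + 2`, `0 ≤ j ≤ n + 2` are distinct
vertices, `hor i j` is a dart from `vert i j` to `vert (i + 1) j`, `ver i j` is a dart from
`vert i j` to `vert i (j + 1)`, and each of the `(m + 2)(n + 2)` unit squares is a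
plaquette of the lattice. `A` consists of the squares with `1 ≤ i ≤ m`, `1 ≤ j ≤ n`.
Values outside of these ranges of indices play no role. -/
structure Rectangle (Λ : SurfaceLattice) where
  m : ℕ
  n : ℕ
  one_le_m : 1 ≤ m
  one_le_n : 1 ≤ n
  vert : ℕ → ℕ → Λ.V
  hor : ℕ → ℕ → Λ.Dart
  ver : ℕ → ℕ → Λ.Dart
  vert_inj : ∀ i ≤ m + 2, ∀ j ≤ n + 2, ∀ i' ≤ m + 2, ∀ j' ≤ n + 2,
    vert i j = vert i' j' → i = i' ∧ j = j'
  hor_start : ∀ i < m + 2, ∀ j ≤ n + 2, Λ.start (hor i j) = vert i j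
  hor_finish : ∀ i < m + 2, ∀ j ≤ n + 2, Λ.finish (hor i j) = vert (i + 1) j
  ver_start : ∀ i ≤ m + 2, ∀ j < n + 2, Λ.start (ver i j) = vert i j
  ver_finish : ∀ i ≤ m + 2, ∀ j < n + 2, Λ.finish (ver i j) = vert i (j + 1)
  next_bottom : ∀ i < m + 2, ∀ j < n + 2, Λ.next (hor i j) = ver (i + 1) j
  next_right : ∀ i < m + 2, ∀ j < n + 2, Λ.next (ver (i + 1) j) = Λ.rev (hor i (j + 1))
  next_top : ∀ i < m + 2, ∀ j < n + 2, Λ.next (Λ.rev (hor i (j + 1))) = Λ.rev (ver i j)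
  next_left : ∀ i < m + 2, ∀ j < n + 2, Λ.next (Λ.rev (ver i j)) = hor i j

namespace Rectangle

variable {Λ : SurfaceLattice} (A : Rectangle Λ)

/-- The edges of `A`, including those on its boundary. -/
def edges : Finset Λ.E :=
  ((Finset.Icc 1 A.m ×ˢ Finset.Icc 1 (A.n + 1)).image fun p => (A.hor p.1 p.2).1) ∪
  ((Finset.Icc 1 (A.m + 1) ×ˢ Finset.Icc 1 A.n).image fun p => (A.ver p.1 p.2).1)

/-- The boundary vertices of `A`. -/
def boundary : Finset Λ.V :=
  ((Finset.Icc 1 (A.m + 1) ×ˢ Finset.Icc 1 (A.n + 1)).filter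
    (fun p => p.1 = 1 ∨ p.1 = A.m + 1 ∨ p.2 = 1 ∨ p.2 = A.n + 1)).image fun p => A.vert p.1 p.2

/-- The number `L` of boundary vertices. -/
def len : ℕ := A.boundary.card

/-- Configurations on the edges of `A`. -/
abbrev InConfig (G : Type*) : Type _ := {e : Λ.E // e ∈ A.edges} → G

/-- Configurations on the edges of the complement of `A`. -/
abbrev OutConfig (G : Type*) : Type _ := {e : Λ.E // e ∉ A.edges} → G

/-- The configuration made of one on `A` and one on the complement. -/
def join {G : Type*} (a : A.InConfig G) (b : A.OutConfig G) : Config G Λ :=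
  fun e => if h : e ∈ A.edges then a ⟨e, h⟩ else b ⟨e, h⟩

end Rectangle

/-! ### Entropies -/

/-- The von Neumann entropy `-∑ λ log λ`, over the eigenvalues `λ` with multiplicity, of an operator
with real eigenvalues (such as a density operator). -/
def vonNeumannEntropy {W : Type*} [AddCommGroup W] [Module ℂ W] [Module.Finite ℂ W]
    (T : W →ₗ[ℂ] W) : ℝ :=
  (T.charpoly.roots.map fun z => Real.negMulLog z.re).sum

/-- A complete list `Ĝ` of the inequivalent irreducible representations of `G`, with a basis
fixed in each. -/
structure Irreps (G : Type*) [Group G] where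
  ι : Type
  [fintypeι : Fintype ι]
  /-- the dimension `d_R` -/
  dim : ι → ℕ
  rep : ∀ R, Representation ℂ G (Fin (dim R) → ℂ)
  irreducible : ∀ R, (rep R).IsIrreducible
  inequivalent : ∀ R R', Nonempty ((rep R).Equiv (rep R')) → R = R'
  complete : ∀ (k : ℕ) (σ : Representation ℂ G (Fin k → ℂ)), σ.IsIrreducible →
    ∃ R, Nonempty ((rep R).Equiv σ)

attribute [instance] Irreps.fintypeι

/-- The representation matrix `D^R(g)`. -/
def Irreps.D {G : Type*} [Group G] (Irr : Irreps G) (R : Irr.ι) (g : G) :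
    Matrix (Fin (Irr.dim R)) (Fin (Irr.dim R)) ℂ :=
  LinearMap.toMatrix' (Irr.rep R g)

section Gauge

variable {G : Type*} [Group G] [Fintype G] [DecidableEq G] {Λ : SurfaceLattice} (A : Rectangle Λ)

/-- The reduced density matrix `Tr_{Ā} |ψ⟩⟨ψ|` in the group basis of `A`. -/
def reduced (ψ : Ket G Λ) : Matrix (A.InConfig G) (A.InConfig G) ℂ :=
  fun a a' => ∑ b : A.OutConfig G, ψ (A.join a b) * star (ψ (A.join a' b))

/-- The extended Hilbert space entropy: the von Neumann entropy of the reduced density matrix. -/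
def extendedEntropy (ψ : Ket G Λ) : ℝ :=
  vonNeumannEntropy (Matrix.toLin' (reduced A ψ))

/-- Extension of an assignment on the boundary vertices by `1` to all vertices. -/
def extend (g : A.boundary → G) : Λ.V → G := fun v => if h : v ∈ A.boundary then g ⟨v, h⟩ else 1

/-- The boundary gauge transformation by `g` on configurations of `A`: it acts at each boundary
vertex, and only on the edges in `A`. -/
def bdryGauge (g : A.boundary → G) (a : A.InConfig G) : A.InConfig G :=
  fun e => extend A g (Λ.src e) * a e * (extend A g (Λ.tgt e))⁻¹

/-- The operator `∏ᵢ A^A_{vᵢ}(gᵢ)` on the Hilbert space of `A`, which sends the basis vector of `a`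
to that of `bdryGauge A g a`. -/
def bdryOp (g : A.boundary → G) : Matrix (A.InConfig G) (A.InConfig G) ℂ :=
  fun a a' => if a = bdryGauge A g a' then 1 else 0

variable (Irr : Irreps G) (R : A.boundary → Irr.ι)

/-- Labels of the basis of `V_{R₁} ⊗ ⋯ ⊗ V_{R_L}`. -/
abbrev TensorIndex : Type := ∀ v : A.boundary, Fin (Irr.dim (R v))

/-- The dimension `d_{R₁} ⋯ d_{R_L}`. -/
def tensorDim : ℕ := ∏ v : A.boundary, Irr.dim (R v)

/-- The matrix of `(g₁, …, g_L)` on `V_{R₁} ⊗ ⋯ ⊗ V_{R_L}`. -/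
def tensorD (g : A.boundary → G) : Matrix (TensorIndex A Irr R) (TensorIndex A Irr R) ℂ :=
  fun i j => ∏ v : A.boundary, Irr.D (R v) (g v) (i v) (j v)

/-- The `G`-invariant tensors in `V_{R₁} ⊗ ⋯ ⊗ V_{R_L}`, for the simultaneous action of `G`. -/
def singlets : Submodule ℂ (TensorIndex A Irr R → ℂ) where
  carrier := {c | ∀ g : G, Matrix.mulVec (tensorD A Irr R fun _ => g) c = c}
  add_mem' hc hc' g := by rw [Matrix.mulVec_add, hc g, hc' g]
  zero_mem' g := Matrix.mulVec_zero _
  smul_mem' s c hc g := by rw [Matrix.mulVec_smul, hc g]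

/-- The number `N_R` of singlets in `V_{R₁} ⊗ ⋯ ⊗ V_{R_L}`. -/
def numSinglets : ℕ := Module.finrank ℂ (singlets A Irr R)

/-- The multiplicity space `W_R`: the linear maps from `V_{R₁} ⊗ ⋯ ⊗ V_{R_L}` to the Hilbert space
of `A` which intertwine the action of `G^L` on the former with boundary gauge transformations.
The sector of `R` is `V_{R₁} ⊗ ⋯ ⊗ V_{R_L} ⊗ W_R`, where `x ⊗ F` stands for the vector `F x`. -/
def multiplicity : Submodule ℂ (Matrix (A.InConfig G) (TensorIndex A Irr R) ℂ) where
  carrier := {F | ∀ g : A.boundary → G, bdryOp A g * F = F * tensorD A Irr R g}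
  add_mem' hF hF' g := by rw [Matrix.mul_add, Matrix.add_mul, hF g, hF' g]
  zero_mem' g := by rw [Matrix.mul_zero, Matrix.zero_mul]
  smul_mem' s F hF g := by rw [Matrix.mul_smul, Matrix.smul_mul, hF g]

/-! The reduced density matrix of a physical state commutes with boundary gauge transformations. -/

theorem gauge_mul (h k : Λ.V → G) (x : Config G Λ) :
    gauge Λ (h * k) x = gauge Λ h (gauge Λ k x) := by
  funext e
  simp [gauge, mul_assoc]

theorem gauge_one (x : Config G Λ) : gauge Λ (1 : Λ.V → G) x = x := by
  funext e
  simp [gauge]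

theorem IsPhysical.gauge_single {ψ : Ket G Λ} (hψ : IsPhysical ψ) (v : Λ.V) (g : G)
    (x : Config G Λ) : ψ (gauge Λ (Pi.mulSingle v g) x) = ψ x := by
  have key : ∀ y : Config G Λ,
      ψ y = (Fintype.card G : ℂ)⁻¹ * ∑ k : G, ψ (gauge Λ (Pi.mulSingle v k) y) := by
    intro y
    have h1 := congrFun (hψ v) y
    rw [← h1]
    simp only [vertexOp, gaugeOp, LinearMap.smul_apply, LinearMap.sum_apply, Pi.smul_apply,
      Finset.sum_apply, LinearMap.funLeft_apply, smul_eq_mul]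
    congr 1
    exact Fintype.sum_equiv (Equiv.inv G) _ _ (fun k => by simp)
  rw [key x, key (gauge Λ (Pi.mulSingle v g) x)]
  congr 1
  refine Fintype.sum_equiv (Equiv.mulRight g) _ _ (fun k => ?_)
  rw [← gauge_mul, ← Pi.mulSingle_mul]
  rfl

theorem IsPhysical.gauge_apply {ψ : Ket G Λ} (hψ : IsPhysical ψ) (h : Λ.V → G) (x : Config G Λ) :
    ψ (gauge Λ h x) = ψ x := by
  let H : Subgroup (Λ.V → G) :=
    { carrier := {k | ∀ y, ψ (gauge Λ k y) = ψ y}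
      mul_mem' := fun {a b} ha hb y => by rw [gauge_mul, ha, hb]
      one_mem' := fun y => by rw [gauge_one]
      inv_mem' := fun {a} ha y => by
        rw [← ha (gauge Λ a⁻¹ y), ← gauge_mul, mul_inv_cancel, gauge_one] }
  have hmem : h ∈ H :=
    Subgroup.pi_mem_of_mulSingle_mem h (fun v y => hψ.gauge_single v (h v) y)
  exact hmem x

/-- The action of a boundary gauge transformation on the complement of `A`. -/
def outGauge (g : A.boundary → G) (b : A.OutConfig G) : A.OutConfig G :=
  fun e => extend A g (Λ.src e) * b e * (extend A g (Λ.tgt e))⁻¹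

theorem extend_inv (g : A.boundary → G) (v : Λ.V) : extend A g⁻¹ v = (extend A g v)⁻¹ := by
  by_cases h : v ∈ A.boundary <;> simp [extend, h]

theorem gauge_join (g : A.boundary → G) (a : A.InConfig G) (b : A.OutConfig G) :
    gauge Λ (extend A g) (A.join a b) = A.join (bdryGauge A g a) (outGauge A g b) := by
  funext e
  by_cases h : e ∈ A.edges <;> simp [gauge, Rectangle.join, h, bdryGauge, outGauge]

theorem outGauge_inv (g : A.boundary → G) (b : A.OutConfig G) :
    outGauge A g⁻¹ (outGauge A g b) = b := by
  funext e
  simp [outGauge, extend_inv, mul_assoc]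

theorem bdryGauge_inv (g : A.boundary → G) (a : A.InConfig G) :
    bdryGauge A g⁻¹ (bdryGauge A g a) = a := by
  funext e
  simp [bdryGauge, extend_inv, mul_assoc]

theorem reduced_bdryGauge {ψ : Ket G Λ} (hψ : IsPhysical ψ) (g : A.boundary → G)
    (a a' : A.InConfig G) :
    reduced A ψ (bdryGauge A g a) (bdryGauge A g a') = reduced A ψ a a' := by
  let f : A.OutConfig G ≃ A.OutConfig G :=
    { toFun := outGauge A g
      invFun := outGauge A g⁻¹
      left_inv := outGauge_inv A g
      right_inv := fun b => by simpa using outGauge_inv A g⁻¹ b }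
  refine (Fintype.sum_equiv f _ _ (fun b => ?_)).symm
  change _ = ψ (A.join _ (outGauge A g b)) * star (ψ (A.join _ (outGauge A g b)))
  rw [← gauge_join, ← gauge_join, hψ.gauge_apply, hψ.gauge_apply]

theorem reduced_comm {ψ : Ket G Λ} (hψ : IsPhysical ψ) (g : A.boundary → G) :
    bdryOp A g * reduced A ψ = reduced A ψ * bdryOp A g := by
  have hinv : ∀ a a' : A.InConfig G, a = bdryGauge A g a' ↔ bdryGauge A g⁻¹ a = a' := by
    intro a a'
    constructor
    · rintro rfl
      exact bdryGauge_inv A g a'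
    · rintro rfl
      simpa using (bdryGauge_inv A g⁻¹ a).symm
  ext a c
  simp only [Matrix.mul_apply, bdryOp, ite_mul, one_mul, zero_mul, mul_ite, mul_one, mul_zero]
  simp only [hinv, Finset.sum_ite_eq, Finset.mem_univ, if_true]
  simp only [← hinv, Finset.sum_ite_eq', Finset.mem_univ, if_true]
  rw [← reduced_bdryGauge A hψ g, ← (hinv a _).mpr rfl]

/-- The operator on `W_R` by which the reduced density matrix acts on the sector of `R`:
the block of the reduced density matrix in `V_{R₁} ⊗ ⋯ ⊗ V_{R_L} ⊗ W_R` is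
`𝟙 ⊗ sectorOp`, which in the notation of the sector decomposition is
`p_R (𝟙 / d_{R₁}) ⊗ ⋯ ⊗ (𝟙 / d_{R_L}) ⊗ ρ_R`. -/
def sectorOp {ψ : Ket G Λ} (hψ : IsPhysical ψ) :
    multiplicity A Irr R →ₗ[ℂ] multiplicity A Irr R :=
  (mulLeftLinearMap (TensorIndex A Irr R) ℂ (reduced A ψ)).restrict (fun F hF g => by
    rw [mulLeftLinearMap_apply, ← Matrix.mul_assoc, reduced_comm A hψ g, Matrix.mul_assoc, hF g,
      Matrix.mul_assoc])

/-- The probability `p_R`: the trace of the reduced density matrix over the sector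
`V_{R₁} ⊗ ⋯ ⊗ V_{R_L} ⊗ W_R`. -/
def sectorProb {ψ : Ket G Λ} (hψ : IsPhysical ψ) : ℝ :=
  (LinearMap.trace ℂ (TensorProduct ℂ (TensorIndex A Irr R → ℂ) (multiplicity A Irr R))
    (LinearMap.lTensor (TensorIndex A Irr R → ℂ) (sectorOp A Irr R hψ))).re

/-- The state `ρ_R` on `W_R`, determined by `sectorOp = (p_R / (d_{R₁} ⋯ d_{R_L})) ρ_R`
(it is `0`, and irrelevant, if `p_R = 0`). -/
def sectorState {ψ : Ket G Λ} (hψ : IsPhysical ψ) :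
    multiplicity A Irr R →ₗ[ℂ] multiplicity A Irr R :=
  ((tensorDim A Irr R : ℂ) / (sectorProb A Irr R hψ : ℂ)) • sectorOp A Irr R hψ

/-- The classical term `-∑ p_R log p_R`. -/
def classicalTerm {ψ : Ket G Λ} (hψ : IsPhysical ψ) : ℝ :=
  ∑ R : A.boundary → Irr.ι, Real.negMulLog (sectorProb A Irr R hψ)

/-- The "log dim R" term `∑ p_R ∑ᵢ log d_{Rᵢ}`. -/
def logDimTerm {ψ : Ket G Λ} (hψ : IsPhysical ψ) : ℝ :=
  ∑ R : A.boundary → Irr.ι,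
    sectorProb A Irr R hψ * ∑ v : A.boundary, Real.log (Irr.dim (R v))

/-- The distillable entropy `∑ p_R S(ρ_R)`. -/
def distillableEntropy {ψ : Ket G Λ} (hψ : IsPhysical ψ) : ℝ :=
  ∑ R : A.boundary → Irr.ι,
    sectorProb A Irr R hψ * vonNeumannEntropy (sectorState A Irr R hψ)

/-- The algebraic entropy `-∑ p_R log p_R + ∑ p_R S(ρ_R)`. -/
def algebraicEntropy {ψ : Ket G Λ} (hψ : IsPhysical ψ) : ℝ :=
  classicalTerm A Irr hψ + distillableEntropy A Irr hψ

end Gauge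

/-! ### Topological entanglement entropy -/

/-- A lattice on a closed oriented surface, a rectangular region, and a normalized ground state. -/
structure GroundData (G : Type*) [Group G] [Fintype G] [DecidableEq G] where
  lattice : SurfaceLattice
  region : Rectangle lattice
  ψ : Ket G lattice
  ground : IsGround ψ
  normalized : ∑ x, ‖ψ x‖ ^ 2 = 1

/-- For regions of boundary length `L k → ∞` with entropies `S k`, the topological entanglement
entropy is `s` if `S = α L - γ + o(1)` with nonnegative constants `α`, `γ`, and `s = -γ`. -/
def IsTopologicalEntropy (L : ℕ → ℕ) (S : ℕ → ℝ) (s : ℝ) : Prop :=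
  ∃ α γ : ℝ, 0 ≤ α ∧ 0 ≤ γ ∧ s = -γ ∧
    Tendsto (fun k => S k - (α * (L k : ℝ) - γ)) atTop (𝓝 0)

end QuantumDouble

end

noncomputable section

namespace QuantumDouble

open Filter Topology

set_option linter.unusedSectionVars false

/-! ### Characters of finite groups -/

/-! Everything follows from the shape of the reduced density matrix ρ of a ground state. Flatness
makes every configuration of `A` in its support pure gauge, `inGauge A h 1`, since a rectangle of
squares has no holes (`IsFlat.exists_potential`). Flatness of the surrounding squares lets the
outside fix the edges on the boundary of `A`, so a nonzero entry of ρ joins `inGauge A h 1` and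
`inGauge A h' 1` with h = h' on the boundary vertices, after a constant has been absorbed
(`exists_of_reduced_ne_zero`). Conversely, gauge invariance makes all these entries equal, because
interior gauge transformations act independently on ket and bra (`reduced_inGauge`). Thus ρ is
constant on equal blocks. The blocks correspond to G^L modulo constants, and so ρ is a projector
divided by |G|^(L-1) (`reduced_mul_self`); this gives S(ρ).

For the sectors, averaging over G^L projects onto the multiplicity space. The trace of ρ there is an
average of tr(ρ g) against a product of characters, and ρ lets only constant g survive
(`sum_mul_trace_reduced_mul_bdryOp`). What remains is the character formula for the number of
singlets. Hence p_R = N_R d_R / |G|^(L-1), and ρ_R is maximally mixed on N_R dimensions.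

The identity ∑ d_R χ_R(k) = |G| δ_{k,1} then shows that each single R_i has the Plancherel
distribution d_R²/|G| (`sum_sectorProb_mul`), which evaluates the log dim term. Since -log p_R =
(L-1) log|G| - log N_R - ∑ log d_{R_i}, the algebraic entropy is S(ρ) minus that term. These
entropies are exactly affine in L, as is the vanishing distillable entropy of an Abelian group, and
L → ∞ determines the constant term. -/

theorem isIrreducible_of_equiv {G V W : Type*} [Group G] [AddCommGroup V] [Module ℂ V]
    [AddCommGroup W] [Module ℂ W] {σ : Representation ℂ G V} {τ : Representation ℂ G W}
    (e : V ≃ₗ[ℂ] W) (he : ∀ g v, e (σ g v) = τ g (e v)) (hσ : σ.IsIrreducible) :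
    τ.IsIrreducible := by
  let c : Subrepresentation τ → Subrepresentation σ := fun U =>
    ⟨U.toSubmodule.comap e.toLinearMap, fun g v hv => by
      have := U.apply_mem_toSubmodule g hv
      rw [Submodule.mem_comap]
      convert! this using 1
      exact he g v⟩
  have hinj : Function.Injective c := fun U U' h => by
    refine Subrepresentation.toSubmodule_injective
      (Submodule.comap_injective_of_surjective e.surjective ?_)
    exact congrArg Subrepresentation.toSubmodule h
  have hbot : c ⊥ = ⊥ := Subrepresentation.toSubmodule_injective (LinearEquiv.ker e)
  have htop : c ⊤ = ⊤ := Subrepresentation.toSubmodule_injective (Submodule.comap_top _)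
  refine @IsSimpleOrder.mk _ _ _ ⟨⊥, ⊤, fun h => ?_⟩ fun U => ?_
  · have := congrArg c h
    rw [hbot, htop] at this
    exact bot_ne_top this
  · rcases eq_bot_or_eq_top (c U) with h | h
    · exact Or.inl (hinj (h.trans hbot.symm))
    · exact Or.inr (hinj (h.trans htop.symm))

namespace Irreps

variable {G : Type*} [Group G] (Irr : Irreps G)

/-- The character of the irreducible representation `R`. -/
def χ (R : Irr.ι) (g : G) : ℂ := (Irr.rep R).character g

theorem trace_D (R : Irr.ι) (g : G) : (Irr.D R g).trace = Irr.χ R g := by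
  rw [χ, Representation.character, D, ← Matrix.trace_toLin'_eq, Matrix.toLin'_toMatrix']

theorem χ_one (R : Irr.ι) : Irr.χ R 1 = Irr.dim R := by
  simp [χ]

theorem D_one (R : Irr.ι) : Irr.D R 1 = 1 := by
  simp [D]

theorem D_mul (R : Irr.ι) (g h : G) : Irr.D R (g * h) = Irr.D R g * Irr.D R h := by
  simp [D, Module.End.mul_eq_comp, LinearMap.toMatrix'_comp]

theorem one_le_dim (R : Irr.ι) : 1 ≤ Irr.dim R := by
  have := Irr.irreducible R
  rw [Nat.one_le_iff_ne_zero]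
  intro h0
  have : IsEmpty (Fin (Irr.dim R)) := by rw [h0]; infer_instance
  obtain ⟨x, y, hxy⟩ := exists_pair_ne (Subrepresentation (Irr.rep R))
  exact hxy (Subrepresentation.toSubmodule_injective (Subsingleton.elim _ _))

theorem dim_eq_one (hG : ∀ a b : G, a * b = b * a) (R : Irr.ι) : Irr.dim R = 1 := by
  have := Irr.irreducible R
  have : IsMulCommutative G := ⟨⟨hG⟩⟩
  simpa using Representation.IsIrreducible.finrank_eq_one_of_isMulCommutative (Irr.rep R)

variable [Fintype G]

-- Schur orthogonality; `inequivalent` turns isomorphism of the two representations into equality of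
-- labels.
open scoped Classical in
theorem sum_χ_mul_χ_inv (R S : Irr.ι) :
    ∑ g : G, Irr.χ R g * Irr.χ S g⁻¹ = if R = S then (Fintype.card G : ℂ) else 0 := by
  have hc : (Nat.card G : ℂ) ≠ 0 := by simp
  let _ : Invertible (Nat.card G : ℂ) := invertibleOfNonzero hc
  have := Irr.irreducible R
  have := Irr.irreducible S
  have h := Representation.char_orthonormal (Irr.rep R) (Irr.rep S)
  rw [inv_mul_eq_iff_eq_mul₀ hc] at h
  have hiff : Nonempty ((Irr.rep S).Equiv (Irr.rep R)) ↔ R = S := by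
    constructor
    · intro h; exact (Irr.inequivalent _ _ h).symm
    · rintro rfl; exact ⟨Representation.Equiv.refl _⟩
  simp only [hiff] at h
  change ∑ g : G, (Irr.rep R).character g * (Irr.rep S).character g⁻¹ = _
  rw [h]
  simp

/-- The character of every finite-dimensional representation is a linear combination of
irreducible characters. -/
theorem exists_character_eq_sum (n : ℕ) : ∀ {V : Type*} [AddCommGroup V] [Module ℂ V]
    [FiniteDimensional ℂ V] (σ : Representation ℂ G V), Module.finrank ℂ V = n →
    ∃ c : Irr.ι → ℂ, ∀ g, σ.character g = ∑ R, c R * Irr.χ R g := by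
  classical
  induction n using Nat.strong_induction_on with
  | _ n ih =>
  intro V _ _ _ σ hn
  by_cases hirr : σ.IsIrreducible
  -- Completeness of the list speaks only of representations on `Fin n → ℂ`, so σ is transported
  -- there by a basis.
  · let e : V ≃ₗ[ℂ] (Fin n → ℂ) := (Module.finBasisOfFinrankEq ℂ V hn).equivFun
    let τ : Representation ℂ G (Fin n → ℂ) :=
      { toFun := fun g => e.conj (σ g)
        map_one' := by simp [Module.End.one_eq_id]
        map_mul' := fun g h => by simp [Module.End.mul_eq_comp, LinearEquiv.conj_comp] }
    let E : σ.Equiv τ := Representation.Equiv.mk e (fun g => by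
      ext v; simp [τ, LinearEquiv.conj_apply])
    have hτ : τ.IsIrreducible := isIrreducible_of_equiv e (fun g v => by
      simp [τ, LinearEquiv.conj_apply]) hirr
    obtain ⟨R, ⟨F⟩⟩ := Irr.complete n τ hτ
    refine ⟨Pi.single R 1, fun g => ?_⟩
    rw [Representation.char_iso (E.trans F.symm)]
    simp [Pi.single_apply, χ]
  -- The zero space is not irreducible, yet has no proper nonzero subrepresentation to split off.
  · by_cases hsub : Subsingleton V
    · refine ⟨0, fun g => ?_⟩
      have : σ g = 0 := Subsingleton.elim _ _
      simp [Representation.character, this]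
    · rw [not_subsingleton_iff_nontrivial] at hsub
      have hW : ∃ W : Subrepresentation σ, W ≠ ⊥ ∧ W ≠ ⊤ := by
        by_contra! hcon
        have : Nontrivial (Subrepresentation σ) := ⟨⊥, ⊤, fun h => by
          have := congrArg Subrepresentation.toSubmodule h
          exact bot_ne_top this⟩
        exact hirr ⟨fun W => or_iff_not_imp_left.mpr (hcon W)⟩
      obtain ⟨W, hW0, hW1⟩ := hW
      have : NeZero (Nat.card G : ℂ) := ⟨by simp⟩
      -- Maschke's theorem; both summands have smaller dimension and traces add.
      obtain ⟨U, hU⟩ := exists_isCompl W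
      have hcompl : IsCompl W.toSubmodule U.toSubmodule := by
        constructor
        · rw [disjoint_iff, ← Subrepresentation.toSubmodule_inf, hU.inf_eq_bot]; rfl
        · rw [codisjoint_iff, ← Subrepresentation.toSubmodule_sup, hU.sup_eq_top]; rfl
      have hsum := Submodule.finrank_add_eq_of_isCompl hcompl
      have hWlt : Module.finrank ℂ W.toSubmodule < n := by
        rw [← hn]
        refine Submodule.finrank_lt (fun h => hW1 (Subrepresentation.toSubmodule_injective h))
      have hUlt : Module.finrank ℂ U.toSubmodule < n := by
        have : 0 < Module.finrank ℂ W.toSubmodule := by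
          rw [Nat.pos_iff_ne_zero, Ne, Submodule.finrank_eq_zero]
          exact fun h => hW0 (Subrepresentation.toSubmodule_injective h)
        omega
      obtain ⟨c, hc⟩ := ih _ hWlt W.toRepresentation rfl
      obtain ⟨c', hc'⟩ := ih _ hUlt U.toRepresentation rfl
      refine ⟨c + c', fun g => ?_⟩
      let N : Bool → Submodule ℂ V := fun b => cond b W.toSubmodule U.toSubmodule
      have hN : DirectSum.IsInternal N :=
        (DirectSum.isInternal_submodule_iff_isCompl N (i := true) (j := false) (by simp)
          (by ext b; cases b <;> simp)).mpr hcompl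
      have hmap : ∀ b, Set.MapsTo (σ g) (N b) (N b) := by
        intro b
        cases b
        · exact U.apply_mem_toSubmodule g
        · exact W.apply_mem_toSubmodule g
      have htr := LinearMap.trace_eq_sum_trace_restrict hN hmap
      rw [Fintype.sum_bool] at htr
      simp only [Pi.add_apply, add_mul, Finset.sum_add_distrib, ← hc, ← hc']
      exact htr

/-- The character of the regular representation. -/
theorem sum_dim_mul_χ [DecidableEq G] (g : G) :
    ∑ R, (Irr.dim R : ℂ) * Irr.χ R g = if g = 1 then (Fintype.card G : ℂ) else 0 := by
  let reg : Representation ℂ G (G → ℂ) :=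
    { toFun := fun s => LinearMap.funLeft ℂ ℂ fun t => s⁻¹ * t
      map_one' := by ext; simp
      map_mul' := fun _ _ => by ext; simp [LinearMap.funLeft_apply, mul_assoc] }
  have hreg : ∀ s : G, reg.character s
      = if s = 1 then (Fintype.card G : ℂ) else 0 := by
    intro s
    rw [Representation.character, LinearMap.trace_eq_matrix_trace ℂ (Pi.basisFun ℂ G),
      Matrix.trace]
    have : ∀ t : G, (LinearMap.toMatrix (Pi.basisFun ℂ G) (Pi.basisFun ℂ G)
        (reg s)).diag t = if s = 1 then 1 else 0 := by
      intro t
      simp [reg, LinearMap.funLeft_apply,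
        Pi.single_apply]
    simp only [this]
    split_ifs <;> simp
  obtain ⟨c, hc⟩ := Irr.exists_character_eq_sum _ reg rfl
  have hcard : (Fintype.card G : ℂ) ≠ 0 := by simp
  -- The coefficient at S is found by pairing with χ_S: orthogonality gives c_S |G|, while the
  -- regular character is concentrated at 1 and gives |G| d_S.
  have hcS : ∀ S, c S = Irr.dim S := by
    classical
    intro S
    have h1 : ∑ g : G, (∑ R, c R * Irr.χ R g) * Irr.χ S g⁻¹ = c S * Fintype.card G := by
      simp only [Finset.sum_mul]
      rw [Finset.sum_comm]
      simp only [mul_assoc, ← Finset.mul_sum, sum_χ_mul_χ_inv]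
      simp
    have h2 : ∑ g : G, (∑ R, c R * Irr.χ R g) * Irr.χ S g⁻¹ = Fintype.card G * Irr.dim S := by
      simp only [← hc, hreg]
      simp [χ_one]
    rw [h1, mul_comm] at h2
    exact mul_left_cancel₀ hcard h2
  rw [← hreg, hc]
  simp only [hcS]

theorem sum_dim_sq : ∑ R, (Irr.dim R : ℝ) ^ 2 = Fintype.card G := by
  classical
  have h := Irr.sum_dim_mul_χ 1
  simp only [χ_one, if_true, ← sq] at h
  exact_mod_cast h

theorem log_dim_le (R : Irr.ι) : Real.log (Irr.dim R) ≤ Real.log (Fintype.card G) := by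
  have h1 : (1 : ℝ) ≤ Irr.dim R := by exact_mod_cast Irr.one_le_dim R
  refine Real.log_le_log (by linarith) ?_
  rw [← Irr.sum_dim_sq]
  calc (Irr.dim R : ℝ) ≤ (Irr.dim R : ℝ) ^ 2 := by nlinarith
    _ ≤ _ := Finset.single_le_sum (f := fun R => (Irr.dim R : ℝ) ^ 2) (fun _ _ => by positivity)
      (Finset.mem_univ R)

end Irreps

/-! ### Counting singlets with characters -/

section Singlets

variable {G : Type*} [Group G] [Fintype G] [DecidableEq G] {Λ : SurfaceLattice} (A : Rectangle Λ)
  (Irr : Irreps G) (R : A.boundary → Irr.ι)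

theorem tensorD_one : tensorD A Irr R 1 = 1 := by
  ext i j
  simp only [tensorD, Pi.one_apply, Irreps.D_one, Matrix.one_apply]
  by_cases h : i = j
  · simp [h]
  · obtain ⟨v, hv⟩ := Function.ne_iff.mp h
    rw [if_neg h]
    exact Finset.prod_eq_zero (Finset.mem_univ v) (if_neg hv)

theorem tensorD_mul (g h : A.boundary → G) :
    tensorD A Irr R (g * h) = tensorD A Irr R g * tensorD A Irr R h := by
  ext i j
  simp only [tensorD, Pi.mul_apply, Irreps.D_mul, Matrix.mul_apply, ← Finset.prod_mul_distrib]
  rw [Finset.prod_univ_sum, Fintype.piFinset_univ]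

theorem trace_tensorD (g : A.boundary → G) :
    (tensorD A Irr R g).trace = ∏ v, Irr.χ (R v) (g v) := by
  simp only [← Irreps.trace_D, Matrix.trace, Matrix.diag, tensorD]
  rw [Finset.prod_univ_sum, Fintype.piFinset_univ]

/-- The average of the diagonal action over G projects onto the singlets, and its trace is the
dimension of its image. -/
theorem card_mul_numSinglets :
    (Fintype.card G : ℂ) * numSinglets A Irr R = ∑ k : G, ∏ v, Irr.χ (R v) k := by
  let σ : Representation ℂ G (TensorIndex A Irr R → ℂ) :=
    { toFun := fun k => Matrix.toLin' (tensorD A Irr R fun _ => k)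
      map_one' := by
        rw [show (fun _ : A.boundary => (1 : G)) = 1 from rfl, tensorD_one, Matrix.toLin'_one]
        rfl
      map_mul' := fun k l => by
        rw [show (fun _ : A.boundary => k * l) = (fun _ => k) * fun _ => l from rfl,
          tensorD_mul, Matrix.toLin'_mul]
        rfl }
  have hc : (Nat.card G : ℂ) ≠ 0 := by simp
  let _ : Invertible (Nat.card G : ℂ) := invertibleOfNonzero hc
  have h := Representation.card_inv_mul_sum_char_eq_finrank σ
  rw [inv_mul_eq_iff_eq_mul₀ hc] at h
  have hinv : σ.invariants = singlets A Irr R := by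
    ext x
    simp [Representation.mem_invariants, singlets, σ]
  rw [hinv, Nat.card_eq_fintype_card] at h
  rw [numSinglets, ← h]
  refine Finset.sum_congr rfl fun k _ => ?_
  rw [← trace_tensorD A Irr R fun _ => k]
  exact Matrix.trace_toLin'_eq _

theorem numSinglets_le : numSinglets A Irr R ≤ tensorDim A Irr R := by
  refine (Submodule.finrank_le _).trans ?_
  simp [tensorDim, TensorIndex]

/-- A weighted count of singlets, in which one boundary vertex carries the weight `w`. -/
theorem sum_numSinglets_mul_tensorDim_mul (hA : 1 < Fintype.card A.boundary) (u : A.boundary)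
    (w : Irr.ι → ℝ) :
    ∑ R : A.boundary → Irr.ι, (numSinglets A Irr R : ℝ) * tensorDim A Irr R * w (R u) =
      (Fintype.card G : ℝ) ^ (Fintype.card A.boundary - 2) *
        ∑ r, (Irr.dim r : ℝ) ^ 2 * w r := by
  have hcard : (Fintype.card G : ℂ) ≠ 0 := by simp
  -- For fixed k the summand factorizes over the vertices, so the sum over R is a product of sums
  -- over one label each.
  let f : G → A.boundary → Irr.ι → ℂ := fun k v r =>
    Irr.dim r * Irr.χ r k * if v = u then (w r : ℂ) else 1
  have hf : ∀ k (R : A.boundary → Irr.ι),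
      ∏ v, f k v (R v) = (∏ v, Irr.χ (R v) k) * tensorDim A Irr R * w (R u) := by
    intro k R
    simp only [f, Finset.prod_mul_distrib, tensorDim, Nat.cast_prod]
    rw [Finset.prod_ite_eq' Finset.univ u (fun v => (w (R v) : ℂ))]
    simp only [Finset.mem_univ, if_true]
    ring
  have hsum : ∀ k, ∑ R : A.boundary → Irr.ι, ∏ v, f k v (R v) =
      if k = 1 then (Fintype.card G : ℂ) ^ (Fintype.card A.boundary - 1) *
        ∑ r, (Irr.dim r : ℂ) ^ 2 * w r else 0 := by
    intro k
    rw [← Fintype.piFinset_univ, ← Finset.prod_univ_sum,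
      ← Finset.mul_prod_erase Finset.univ _ (Finset.mem_univ u)]
    have h1 : ∀ v ∈ Finset.univ.erase u, ∑ r, f k v r
        = if k = 1 then (Fintype.card G : ℂ) else 0 := by
      intro v hv
      simp only [f, if_neg (Finset.ne_of_mem_erase hv), mul_one]
      exact Irr.sum_dim_mul_χ k
    rw [Finset.prod_congr rfl h1, Finset.prod_const, Finset.card_erase_of_mem (Finset.mem_univ u),
      Finset.card_univ]
    split_ifs with hk
    · subst hk
      rw [mul_comm]
      simp only [f, if_true, Irreps.χ_one, ← sq]
    -- For k ≠ 1 a vertex other than u contributes the factor 0; this needs at least two boundary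
    -- vertices.
    · rw [zero_pow (by omega), mul_zero]
  have key : (Fintype.card G : ℂ) *
      ∑ R : A.boundary → Irr.ι, (numSinglets A Irr R : ℂ) * tensorDim A Irr R * w (R u) =
      (Fintype.card G : ℂ) ^ (Fintype.card A.boundary - 1) *
        ∑ r, (Irr.dim r : ℂ) ^ 2 * w r := by
    simp only [Finset.mul_sum, ← mul_assoc, card_mul_numSinglets, Finset.sum_mul]
    rw [Finset.sum_comm]
    simp only [← hf, hsum]
    simp [Finset.mul_sum, mul_assoc]
  rw [show Fintype.card A.boundary - 1 = (Fintype.card A.boundary - 2) + 1 by omega, pow_succ',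
    mul_assoc] at key
  exact_mod_cast mul_left_cancel₀ hcard key

end Singlets

/-! ### Flat configurations on a rectangle -/

theorem SurfaceLattice.start_rev {Λ : SurfaceLattice} (d : Λ.Dart) :
    Λ.start (Λ.rev d) = Λ.finish d := by
  obtain ⟨e, b⟩ := d
  cases b <;> rfl

section DartValue

variable {G : Type*} [Group G] {Λ : SurfaceLattice}

theorem dartValue_rev (x : Config G Λ) (d : Λ.Dart) :
    dartValue Λ x (Λ.rev d) = (dartValue Λ x d)⁻¹ := by
  obtain ⟨e, b⟩ := d
  cases b <;> simp [dartValue, SurfaceLattice.rev]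

theorem dartValue_congr {x x' : Config G Λ} {d : Λ.Dart} (h : x d.1 = x' d.1) :
    dartValue Λ x d = dartValue Λ x' d := by
  simp [dartValue, h]

/-- Allows arguing along grid darts, whose direction need not be the orientation of the edge. -/
theorem dartValue_eq_iff {x : Config G Λ} {h : Λ.V → G} (d : Λ.Dart) :
    dartValue Λ x d = h (Λ.start d) * (h (Λ.finish d))⁻¹ ↔
      x d.1 = h (Λ.src d.1) * (h (Λ.tgt d.1))⁻¹ := by
  obtain ⟨e, b⟩ := d
  cases b
  · simp [dartValue, SurfaceLattice.start, SurfaceLattice.finish, inv_eq_iff_eq_inv]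
  · simp [dartValue, SurfaceLattice.start, SurfaceLattice.finish]

end DartValue

theorem eq_of_forall_succ_eq {α : Type*} {q : ℕ → α} {a b : ℕ}
    (h : ∀ i, a ≤ i → i < b → q i = q (i + 1)) (i : ℕ) (ha : a ≤ i) (hb : i ≤ b) : q i = q a := by
  induction i, ha using Nat.le_induction with
  | base => rfl
  | succ k hk ih => rw [← h k hk (by omega), ih (by omega)]

/-! ### Incidence of vertices and edges in the rectangle -/

namespace Rectangle

variable {Λ : SurfaceLattice} (A : Rectangle Λ)

/-- The vertices of `A`. -/
def verts : Finset Λ.V :=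
  (Finset.Icc 1 (A.m + 1) ×ˢ Finset.Icc 1 (A.n + 1)).image fun p => A.vert p.1 p.2

variable {A}

theorem vert_mem_verts {i j : ℕ} (hi : 1 ≤ i) (hi' : i ≤ A.m + 1) (hj : 1 ≤ j)
    (hj' : j ≤ A.n + 1) : A.vert i j ∈ A.verts :=
  Finset.mem_image.mpr ⟨(i, j), by simp; omega, rfl⟩

theorem mem_verts {v : Λ.V} : v ∈ A.verts ↔
    ∃ i j, 1 ≤ i ∧ i ≤ A.m + 1 ∧ 1 ≤ j ∧ j ≤ A.n + 1 ∧ A.vert i j = v := by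
  constructor
  · intro h
    obtain ⟨⟨i, j⟩, hp, rfl⟩ := Finset.mem_image.mp h
    simp only [Finset.mem_product, Finset.mem_Icc] at hp
    exact ⟨i, j, hp.1.1, hp.1.2, hp.2.1, hp.2.2, rfl⟩
  · rintro ⟨i, j, h1, h2, h3, h4, rfl⟩
    exact vert_mem_verts h1 h2 h3 h4

theorem mem_boundary {v : Λ.V} : v ∈ A.boundary ↔
    ∃ i j, 1 ≤ i ∧ i ≤ A.m + 1 ∧ 1 ≤ j ∧ j ≤ A.n + 1 ∧
      (i = 1 ∨ i = A.m + 1 ∨ j = 1 ∨ j = A.n + 1) ∧ A.vert i j = v := by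
  constructor
  · intro h
    obtain ⟨⟨i, j⟩, hp, rfl⟩ := Finset.mem_image.mp h
    simp only [Finset.mem_filter, Finset.mem_product, Finset.mem_Icc] at hp
    exact ⟨i, j, hp.1.1.1, hp.1.1.2, hp.1.2.1, hp.1.2.2, hp.2, rfl⟩
  · rintro ⟨i, j, h1, h2, h3, h4, h5, rfl⟩
    exact Finset.mem_image.mpr ⟨(i, j), by simp; omega, rfl⟩

theorem vert_notMem_verts {i j : ℕ} (hi : i ≤ A.m + 2) (hj : j ≤ A.n + 2)
    (h : i = 0 ∨ i = A.m + 2 ∨ j = 0 ∨ j = A.n + 2) : A.vert i j ∉ A.verts := by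
  intro hv
  obtain ⟨i', j', h1, h2, h3, h4, h5⟩ := mem_verts.mp hv
  have := A.vert_inj i' (by omega) j' (by omega) i hi j hj h5
  omega

theorem hor_mem_edges {i j : ℕ} (hi : 1 ≤ i) (hi' : i ≤ A.m) (hj : 1 ≤ j) (hj' : j ≤ A.n + 1) :
    (A.hor i j).1 ∈ A.edges :=
  Finset.mem_union_left _ (Finset.mem_image.mpr ⟨(i, j), by simp; omega, rfl⟩)

theorem ver_mem_edges {i j : ℕ} (hi : 1 ≤ i) (hi' : i ≤ A.m + 1) (hj : 1 ≤ j) (hj' : j ≤ A.n) :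
    (A.ver i j).1 ∈ A.edges :=
  Finset.mem_union_right _ (Finset.mem_image.mpr ⟨(i, j), by simp; omega, rfl⟩)

theorem forall_mem_edges {P : Λ.E → Prop}
    (hor : ∀ i j, 1 ≤ i → i ≤ A.m → 1 ≤ j → j ≤ A.n + 1 → P (A.hor i j).1)
    (ver : ∀ i j, 1 ≤ i → i ≤ A.m + 1 → 1 ≤ j → j ≤ A.n → P (A.ver i j).1) :
    ∀ e ∈ A.edges, P e := by
  intro e he
  rcases Finset.mem_union.mp he with h | h <;> obtain ⟨⟨i, j⟩, hp, rfl⟩ := Finset.mem_image.mp h <;>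
    simp only [Finset.mem_product, Finset.mem_Icc] at hp
  · exact hor i j hp.1.1 hp.1.2 hp.2.1 hp.2.2
  · exact ver i j hp.1.1 hp.1.2 hp.2.1 hp.2.2

theorem start_finish_mem {d : Λ.Dart} (hs : Λ.start d ∈ A.verts) (hf : Λ.finish d ∈ A.verts) :
    Λ.src d.1 ∈ A.verts ∧ Λ.tgt d.1 ∈ A.verts := by
  obtain ⟨e, b⟩ := d
  cases b
  · exact ⟨hf, hs⟩
  · exact ⟨hs, hf⟩

theorem src_tgt_mem_verts : ∀ e ∈ A.edges, Λ.src e ∈ A.verts ∧ Λ.tgt e ∈ A.verts := by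
  refine forall_mem_edges (fun i j h1 h2 h3 h4 => ?_) (fun i j h1 h2 h3 h4 => ?_)
  · refine start_finish_mem ?_ ?_
    · rw [A.hor_start i (by omega) j (by omega)]
      exact vert_mem_verts h1 (by omega) h3 h4
    · rw [A.hor_finish i (by omega) j (by omega)]
      exact vert_mem_verts (by omega) (by omega) h3 h4
  · refine start_finish_mem ?_ ?_
    · rw [A.ver_start i (by omega) j (by omega)]
      exact vert_mem_verts h1 h2 h3 (by omega)
    · rw [A.ver_finish i (by omega) j (by omega)]
      exact vert_mem_verts h1 h2 (by omega) (by omega)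

theorem notMem_edges {d : Λ.Dart} (h : Λ.start d ∉ A.verts ∨ Λ.finish d ∉ A.verts) :
    d.1 ∉ A.edges := by
  intro he
  obtain ⟨h1, h2⟩ := src_tgt_mem_verts _ he
  obtain ⟨e, b⟩ := d
  cases b <;> simp_all [SurfaceLattice.start, SurfaceLattice.finish]

theorem hor_notMem_edges {i j : ℕ} (hi : i < A.m + 2) (hj : j ≤ A.n + 2)
    (h : i = 0 ∨ i = A.m + 1 ∨ j = 0 ∨ j = A.n + 2) : (A.hor i j).1 ∉ A.edges := by
  refine notMem_edges ?_
  rw [A.hor_start i hi j hj, A.hor_finish i hi j hj]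
  by_cases h' : i = A.m + 1
  · exact Or.inr (vert_notMem_verts (by omega) hj (by omega))
  · exact Or.inl (vert_notMem_verts (by omega) hj (by omega))

theorem ver_notMem_edges {i j : ℕ} (hi : i ≤ A.m + 2) (hj : j < A.n + 2)
    (h : i = 0 ∨ i = A.m + 2 ∨ j = 0 ∨ j = A.n + 1) : (A.ver i j).1 ∉ A.edges := by
  refine notMem_edges ?_
  rw [A.ver_start i hi j hj, A.ver_finish i hi j hj]
  by_cases h' : j = A.n + 1
  · exact Or.inr (vert_notMem_verts hi (by omega) (by omega))
  · exact Or.inl (vert_notMem_verts hi (by omega) (by omega))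

/-- All edges at an interior vertex of `A` belong to `A`. -/
theorem mem_edges_of_start {i j : ℕ} (hi : 1 ≤ i) (hi' : i < A.m) (hj : 1 ≤ j) (hj' : j < A.n)
    {d : Λ.Dart} (hd : Λ.start d = A.vert (i + 1) (j + 1)) : d.1 ∈ A.edges := by
  obtain ⟨k, rfl⟩ := Λ.rotation_transitive (A.hor (i + 1) (j + 1)) d
    ((A.hor_start (i + 1) (by omega) (j + 1) (by omega)).trans hd.symm)
  -- These four darts are closed under rotation about the vertex, and by `rotation_transitive` the
  -- orbit contains every dart leaving it.
  have key : ∀ k : ℕ, (fun c : Λ.E × Bool => Λ.next (c.1, !c.2))^[k] (A.hor (i + 1) (j + 1)) ∈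
      ({A.hor (i + 1) (j + 1), Λ.rev (A.ver (i + 1) j), Λ.rev (A.hor i (j + 1)),
        A.ver (i + 1) (j + 1)} : Set Λ.Dart) := by
    intro k
    induction k with
    | zero => exact Or.inl rfl
    | succ k ih =>
      rw [Function.iterate_succ_apply']
      rcases ih with h | h | h | h <;> rw [h]
      · exact Or.inr (Or.inl (A.next_top (i + 1) (by omega) j (by omega)))
      · refine Or.inr (Or.inr (Or.inl ?_))
        simpa [SurfaceLattice.rev] using A.next_right i (by omega) j (by omega)
      · refine Or.inr (Or.inr (Or.inr ?_))
        simpa [SurfaceLattice.rev] using A.next_bottom i (by omega) (j + 1) (by omega)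
      · exact Or.inl (A.next_left (i + 1) (by omega) (j + 1) (by omega))
  rcases key k with h | h | h | h <;> rw [h]
  · exact hor_mem_edges (by omega) (by omega) (by omega) (by omega)
  · exact ver_mem_edges (by omega) (by omega) (by omega) (by omega)
  · exact hor_mem_edges (by omega) (by omega) (by omega) (by omega)
  · exact ver_mem_edges (by omega) (by omega) (by omega) (by omega)

/-- Ensures that gauge transformations at interior vertices of `A` leave the outside configuration
alone. -/
theorem mem_boundary_of_notMem_edges {e : Λ.E} (he : e ∉ A.edges) {v : Λ.V}
    (hv : v = Λ.src e ∨ v = Λ.tgt e) (hA : v ∈ A.verts) : v ∈ A.boundary := by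
  obtain ⟨i, j, h1, h2, h3, h4, rfl⟩ := mem_verts.mp hA
  refine mem_boundary.mpr ⟨i, j, h1, h2, h3, h4, ?_, rfl⟩
  by_contra! hcon
  obtain ⟨i, rfl⟩ : ∃ i', i = i' + 1 := ⟨i - 1, by omega⟩
  obtain ⟨j, rfl⟩ : ∃ j', j = j' + 1 := ⟨j - 1, by omega⟩
  rcases hv with hv | hv
  · exact he (mem_edges_of_start (d := (e, true)) (by omega) (by omega) (by omega) (by omega)
      hv.symm)
  · exact he (mem_edges_of_start (d := (e, false)) (by omega) (by omega) (by omega) (by omega)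
      hv.symm)

theorem boundary_subset_verts : A.boundary ⊆ A.verts := fun v hv => by
  obtain ⟨i, j, h1, h2, h3, h4, -, rfl⟩ := mem_boundary.mp hv
  exact vert_mem_verts h1 h2 h3 h4

theorem corner_mem_boundary : A.vert 1 1 ∈ A.boundary :=
  mem_boundary.mpr ⟨1, 1, by omega, by omega, by omega, by omega, by omega, rfl⟩

theorem one_lt_card_boundary : 1 < Fintype.card A.boundary := by
  rw [Fintype.card_coe, Finset.one_lt_card]
  refine ⟨_, corner_mem_boundary, A.vert 2 1, ?_, fun h => ?_⟩
  · have := A.one_le_m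
    exact mem_boundary.mpr ⟨2, 1, by omega, by omega, by omega, by omega, by omega, rfl⟩
  · have := A.vert_inj 1 (by omega) 1 (by omega) 2 (by omega) 1 (by omega) h
    omega

/-! ### Holonomy, potentials and rigidity on the boundary -/

variable {G : Type*} [Group G]

/-- Trivial holonomy around a square of the grid. -/
theorem dartValue_mul_eq {x : Config G Λ} {i j : ℕ} (hi : i < A.m + 2) (hj : j < A.n + 2)
    (h : holonomy Λ x (A.hor i j) = 1) :
    dartValue Λ x (A.hor i j) * dartValue Λ x (A.ver (i + 1) j) =
      dartValue Λ x (A.ver i j) * dartValue Λ x (A.hor i (j + 1)) := by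
  have h1 := A.next_bottom i hi j hj
  have h2 := A.next_right i hi j hj
  have h3 := A.next_top i hi j hj
  have h4 := A.next_left i hi j hj
  -- The holonomy is taken over one minimal period, so a return after one or two steps must be
  -- excluded; distinctness of the grid vertices does this.
  have hper : Function.minimalPeriod Λ.next (A.hor i j) = 4 := by
    have hdvd : Function.minimalPeriod Λ.next (A.hor i j) ∣ 4 :=
      Function.IsPeriodicPt.minimalPeriod_dvd (by
        change Λ.next (Λ.next (Λ.next (Λ.next (A.hor i j)))) = A.hor i j
        rw [h1, h2, h3, h4])
    have hit := Function.iterate_minimalPeriod (f := Λ.next) (x := A.hor i j)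
    have hle := Nat.le_of_dvd (by norm_num) hdvd
    generalize Function.minimalPeriod Λ.next (A.hor i j) = p at *
    interval_cases p
    · omega
    · exfalso
      change Λ.next (A.hor i j) = A.hor i j at hit
      have := congrArg Λ.start hit
      rw [h1, A.hor_start i hi j hj.le, A.ver_start (i + 1) (by omega) j hj] at this
      have := A.vert_inj _ (by omega) _ (by omega) _ (by omega) _ (by omega) this
      omega
    · exfalso
      change Λ.next (Λ.next (A.hor i j)) = A.hor i j at hit
      have := congrArg Λ.start hit
      rw [h1, h2, A.hor_start i hi j hj.le, SurfaceLattice.start_rev,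
        A.hor_finish i hi (j + 1) (by omega)] at this
      have := A.vert_inj _ (by omega) _ (by omega) _ (by omega) _ (by omega) this
      omega
    · omega
    · rfl
  rw [holonomy, hper] at h
  simp only [List.range_succ, List.range_zero, List.nil_append, List.map_cons,
    List.map_nil, List.cons_append, List.prod_cons, List.prod_nil, Function.iterate_succ_apply,
    Function.iterate_zero, id, h1, h2, h3, dartValue_rev, mul_one] at h
  rwa [← mul_assoc, ← mul_assoc, mul_inv_eq_one, mul_inv_eq_iff_eq_mul] at h

variable (A) in
/-- Trivial holonomy around all squares of the grid. -/
def IsFlat (x : Config G Λ) : Prop :=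
  ∀ i < A.m + 2, ∀ j < A.n + 2,
    dartValue Λ x (A.hor i j) * dartValue Λ x (A.ver (i + 1) j) =
      dartValue Λ x (A.ver i j) * dartValue Λ x (A.hor i (j + 1))

/-- Discrete integration: the potential is transported up the left column and then along each row.
Horizontal edges are right by construction, vertical ones by flatness, square by square. -/
theorem IsFlat.exists_potential {x : Config G Λ} (hx : A.IsFlat x) :
    ∃ h : Λ.V → G, ∀ e ∈ A.edges, x e = h (Λ.src e) * (h (Λ.tgt e))⁻¹ := by
  -- `C j` and `H i j` are the potentials at `vert 1 (j + 1)` and `vert (i + 1) (j + 1)`: indices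
  -- are shifted so that recursion starts at 0.
  let C : ℕ → G := fun j => Nat.rec 1 (fun k c => (dartValue Λ x (A.ver 1 (k + 1)))⁻¹ * c) j
  let H : ℕ → ℕ → G := fun i j =>
    Nat.rec (C j) (fun k c => (dartValue Λ x (A.hor (k + 1) (j + 1)))⁻¹ * c) i
  have hC : ∀ j, C (j + 1) = (dartValue Λ x (A.ver 1 (j + 1)))⁻¹ * C j := fun _ => rfl
  have hH : ∀ i j, H (i + 1) j = (dartValue Λ x (A.hor (i + 1) (j + 1)))⁻¹ * H i j :=
    fun _ _ => rfl
  have hver : ∀ i ≤ A.m, ∀ j < A.n,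
      dartValue Λ x (A.ver (i + 1) (j + 1)) = H i j * (H i (j + 1))⁻¹ := by
    intro i hi j hj
    induction i with
    | zero =>
      change _ = C j * (C (j + 1))⁻¹
      rw [hC]
      group
    | succ i ih =>
      have h1 := hx (i + 1) (by omega) (j + 1) (by omega)
      rw [ih (by omega)] at h1
      rw [hH, hH, mul_inv_rev, inv_inv]
      rw [← eq_inv_mul_iff_mul_eq] at h1
      rw [h1]
      group
  let h : Λ.V → G := fun v => by
    classical
    exact if hv : ∃ p : ℕ × ℕ, p.1 ≤ A.m ∧ p.2 ≤ A.n ∧ A.vert (p.1 + 1) (p.2 + 1) = v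
      then H hv.choose.1 hv.choose.2 else 1
  have hh : ∀ i ≤ A.m, ∀ j ≤ A.n, h (A.vert (i + 1) (j + 1)) = H i j := by
    intro i hi j hj
    have hv : ∃ p : ℕ × ℕ, p.1 ≤ A.m ∧ p.2 ≤ A.n ∧
        A.vert (p.1 + 1) (p.2 + 1) = A.vert (i + 1) (j + 1) := ⟨(i, j), hi, hj, rfl⟩
    have hs := hv.choose_spec
    have := A.vert_inj _ (by omega) _ (by omega) _ (by omega) _ (by omega) hs.2.2
    simp only [h, dif_pos hv]
    rw [show hv.choose.1 = i by omega, show hv.choose.2 = j by omega]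
  refine ⟨h, forall_mem_edges (fun i j h1 h2 h3 h4 => ?_) (fun i j h1 h2 h3 h4 => ?_)⟩
  · obtain ⟨i, rfl⟩ : ∃ i', i = i' + 1 := ⟨i - 1, by omega⟩
    obtain ⟨j, rfl⟩ : ∃ j', j = j' + 1 := ⟨j - 1, by omega⟩
    rw [← dartValue_eq_iff, A.hor_start _ (by omega) _ (by omega),
      A.hor_finish _ (by omega) _ (by omega), hh i (by omega) j (by omega),
      hh (i + 1) (by omega) j (by omega), hH]
    group
  · obtain ⟨i, rfl⟩ : ∃ i', i = i' + 1 := ⟨i - 1, by omega⟩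
    obtain ⟨j, rfl⟩ : ∃ j', j = j' + 1 := ⟨j - 1, by omega⟩
    rw [← dartValue_eq_iff, A.ver_start _ (by omega) _ (by omega),
      A.ver_finish _ (by omega) _ (by omega), hh i (by omega) j (by omega),
      hh i (by omega) (j + 1) (by omega), hver i (by omega) j (by omega)]

/-- Flat configurations which agree outside of `A` also agree on the boundary edges of `A`. -/
theorem IsFlat.boundary_eq {x x' : Config G Λ} (hx : A.IsFlat x) (hx' : A.IsFlat x')
    (h : ∀ e ∉ A.edges, x e = x' e) :
    (∀ i, 1 ≤ i → i ≤ A.m → ∀ j, j = 1 ∨ j = A.n + 1 →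
      dartValue Λ x (A.hor i j) = dartValue Λ x' (A.hor i j)) ∧
    (∀ j, 1 ≤ j → j ≤ A.n → ∀ i, i = 1 ∨ i = A.m + 1 →
      dartValue Λ x (A.ver i j) = dartValue Λ x' (A.ver i j)) := by
  have hh : ∀ i j, i < A.m + 2 → j ≤ A.n + 2 → (i = 0 ∨ i = A.m + 1 ∨ j = 0 ∨ j = A.n + 2) →
      dartValue Λ x (A.hor i j) = dartValue Λ x' (A.hor i j) := fun i j hi hj hij =>
    dartValue_congr (h _ (hor_notMem_edges hi hj hij))
  have hv : ∀ i j, i ≤ A.m + 2 → j < A.n + 2 → (i = 0 ∨ i = A.m + 2 ∨ j = 0 ∨ j = A.n + 1) →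
      dartValue Λ x (A.ver i j) = dartValue Λ x' (A.ver i j) := fun i j hi hj hij =>
    dartValue_congr (h _ (ver_notMem_edges hi hj hij))
  -- Each boundary edge is a side of a square of the outer frame whose other three sides lie outside
  -- `A`; flatness solves for the fourth.
  refine ⟨fun i h1 h2 j hj => ?_, fun j h1 h2 i hi => ?_⟩
  · rcases hj with rfl | rfl
    · have e := hx i (by omega) 0 (by omega)
      have e' := hx' i (by omega) 0 (by omega)
      rw [hh i 0 (by omega) (by omega) (by omega), hv (i + 1) 0 (by omega) (by omega) (by omega),
        hv i 0 (by omega) (by omega) (by omega), e'] at e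
      exact (mul_left_cancel e).symm
    · have e := hx i (by omega) (A.n + 1) (by omega)
      have e' := hx' i (by omega) (A.n + 1) (by omega)
      rw [hh i (A.n + 1 + 1) (by omega) (by omega) (by omega),
        hv (i + 1) (A.n + 1) (by omega) (by omega) (by omega),
        hv i (A.n + 1) (by omega) (by omega) (by omega), ← e'] at e
      exact mul_right_cancel e
  · rcases hi with rfl | rfl
    · have e := hx 0 (by omega) j (by omega)
      have e' := hx' 0 (by omega) j (by omega)
      rw [hv 0 j (by omega) (by omega) (by omega), hh 0 j (by omega) (by omega) (by omega),
        hh 0 (j + 1) (by omega) (by omega) (by omega), ← e'] at e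
      exact mul_left_cancel e
    · have e := hx (A.m + 1) (by omega) j (by omega)
      have e' := hx' (A.m + 1) (by omega) j (by omega)
      rw [hv (A.m + 1 + 1) j (by omega) (by omega) (by omega),
        hh (A.m + 1) j (by omega) (by omega) (by omega),
        hh (A.m + 1) (j + 1) (by omega) (by omega) (by omega), e'] at e
      exact (mul_right_cancel e).symm

/-- Two potentials of flat configurations which agree on the boundary edges differ by a constant
on the boundary vertices. -/
theorem boundary_const {α : Type*} {q : Λ.V → α}
    (hhor : ∀ i, 1 ≤ i → i ≤ A.m → ∀ j, j = 1 ∨ j = A.n + 1 →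
      q (A.vert i j) = q (A.vert (i + 1) j))
    (hver : ∀ j, 1 ≤ j → j ≤ A.n → ∀ i, i = 1 ∨ i = A.m + 1 →
      q (A.vert i j) = q (A.vert i (j + 1))) :
    ∀ v ∈ A.boundary, q v = q (A.vert 1 1) := by
  have hleft : ∀ j, 1 ≤ j → j ≤ A.n + 1 → q (A.vert 1 j) = q (A.vert 1 1) := fun j h1 h2 =>
    eq_of_forall_succ_eq (q := fun j => q (A.vert 1 j))
      (fun j h h' => hver j h (by omega) 1 (by omega)) j h1 h2
  have hrow : ∀ j, j = 1 ∨ j = A.n + 1 → ∀ i, 1 ≤ i → i ≤ A.m + 1 →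
      q (A.vert i j) = q (A.vert 1 1) := fun j hj i h1 h2 =>
    (eq_of_forall_succ_eq (q := fun i => q (A.vert i j))
      (fun i h h' => hhor i h (by omega) j hj) i h1 h2).trans (hleft j (by omega) (by omega))
  have hright : ∀ j, 1 ≤ j → j ≤ A.n + 1 → q (A.vert (A.m + 1) j) = q (A.vert 1 1) :=
    fun j h1 h2 => (eq_of_forall_succ_eq (q := fun j => q (A.vert (A.m + 1) j))
      (fun j h h' => hver j h (by omega) _ (by omega)) j h1 h2).trans
        (hrow 1 (by omega) _ (by omega) (by omega))
  intro v hv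
  obtain ⟨i, j, h1, h2, h3, h4, h5, rfl⟩ := mem_boundary.mp hv
  rcases h5 with rfl | rfl | h5 | h5
  · exact hleft j h3 h4
  · exact hright j h3 h4
  · exact hrow j (by omega) i h1 h2
  · exact hrow j (by omega) i h1 h2

/-- The grid is connected, so only transformations constant on its vertices fix the trivial
configuration. -/
theorem potential_unique {h : Λ.V → G}
    (hh : ∀ e ∈ A.edges, h (Λ.src e) * (h (Λ.tgt e))⁻¹ = 1) :
    ∀ v ∈ A.verts, h v = h (A.vert 1 1) := by
  have hd : ∀ d : Λ.Dart, d.1 ∈ A.edges → h (Λ.start d) = h (Λ.finish d) := fun d hd => by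
    have := (dartValue_eq_iff (x := 1) (h := h) d).mpr (hh d.1 hd).symm
    rw [← mul_inv_eq_one, ← this]
    simp [dartValue]
  have hcol : ∀ i, 1 ≤ i → i ≤ A.m + 1 → ∀ j, 1 ≤ j → j ≤ A.n + 1 →
      h (A.vert i j) = h (A.vert i 1) := fun i h1 h2 j h3 h4 =>
    eq_of_forall_succ_eq (q := fun j => h (A.vert i j)) (fun j h3 h4 => by
      have := hd _ (ver_mem_edges (A := A) h1 h2 h3 (by omega))
      rwa [A.ver_start _ (by omega) _ (by omega), A.ver_finish _ (by omega) _ (by omega)] at this)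
      j h3 h4
  intro v hv
  obtain ⟨i, j, h1, h2, h3, h4, rfl⟩ := mem_verts.mp hv
  rw [hcol i h1 h2 j h3 h4]
  exact eq_of_forall_succ_eq (q := fun i => h (A.vert i 1)) (fun i h1 h2 => by
      have := hd _ (hor_mem_edges (A := A) h1 (by omega) le_rfl (by omega))
      rwa [A.hor_start _ (by omega) _ (by omega), A.hor_finish _ (by omega) _ (by omega)] at this)
      i h1 h2

end Rectangle

/-! ### The reduced density matrix of a ground state -/

section InGauge

variable {G : Type*} [Group G] {Λ : SurfaceLattice} (A : Rectangle Λ)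

/-- The action on configurations of `A` of a gauge transformation. -/
def inGauge (h : Λ.V → G) (a : A.InConfig G) : A.InConfig G :=
  fun e => h (Λ.src e) * a e * (h (Λ.tgt e))⁻¹

theorem bdryGauge_eq_inGauge (g : A.boundary → G) : bdryGauge A g = inGauge A (extend A g) := rfl

theorem inGauge_mul (h k : Λ.V → G) (a : A.InConfig G) :
    inGauge A (h * k) a = inGauge A h (inGauge A k a) := by
  funext e
  simp [inGauge, mul_assoc]

theorem inGauge_one (a : A.InConfig G) : inGauge A 1 a = a := by
  funext e
  simp [inGauge]

theorem inGauge_const (x : G) : inGauge A (fun _ => x) 1 = (1 : A.InConfig G) := by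
  funext e
  simp [inGauge]

theorem extend_mul (g g' : A.boundary → G) : extend A (g * g') = extend A g * extend A g' := by
  funext v
  by_cases h : v ∈ A.boundary <;> simp [extend, h]

theorem extend_apply (g : A.boundary → G) (v : A.boundary) : extend A g v = g v := by
  simp [extend]

theorem extend_conj (h : Λ.V → G) (g : A.boundary → G) :
    extend A (fun v => h v * g v * (h v)⁻¹) = h * extend A g * h⁻¹ := by
  funext v
  by_cases hv : v ∈ A.boundary <;> simp [extend, hv]

-- The quotient `k⁻¹ * h` fixes the trivial configuration, so the ambiguity of a potential is a
-- constant on the right.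
variable {A} in
theorem eq_const_of_inGauge_eq {h k : Λ.V → G} (hk : inGauge A h 1 = inGauge A k 1) :
    ∃ x, ∀ v ∈ A.boundary, h v = k v * x := by
  have h1 : inGauge A (k⁻¹ * h) 1 = 1 := by
    rw [inGauge_mul, hk, ← inGauge_mul, inv_mul_cancel, inGauge_one]
  refine ⟨(k⁻¹ * h) (A.vert 1 1), fun v hv => ?_⟩
  rw [← Rectangle.potential_unique (h := k⁻¹ * h) (fun e he => ?_) v
    (Rectangle.boundary_subset_verts hv)]
  · simp
  · simpa [inGauge] using congrFun h1 ⟨e, he⟩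

variable [Fintype G] [DecidableEq G]

-- No outside edge touches an interior vertex of `A`. Ket and bra may therefore be transformed
-- differently in the interior, and the common boundary values only permute the outside
-- configurations being summed over.
variable {A} in
theorem reduced_inGauge {ψ : Ket G Λ} (hψ : IsPhysical ψ) {h h' : Λ.V → G}
    (hh : ∀ v ∈ A.boundary, h v = h' v) (a a' : A.InConfig G) :
    reduced A ψ (inGauge A h a) (inGauge A h' a') = reduced A ψ a a' := by
  classical
  let g : A.boundary → G := fun v => h v
  let f : A.OutConfig G ≃ A.OutConfig G :=
    { toFun := outGauge A g
      invFun := outGauge A g⁻¹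
      left_inv := outGauge_inv A g
      right_inv := fun b => by simpa using outGauge_inv A g⁻¹ b }
  have key : ∀ k : Λ.V → G, (∀ v ∈ A.boundary, k v = h v) → ∀ (a : A.InConfig G) b,
      ψ (A.join (inGauge A k a) (f b)) = ψ (A.join a b) := by
    intro k hk a b
    -- Cut off outside the vertices of `A`, so that on outside edges only the boundary values act.
    let l : Λ.V → G := fun v => if v ∈ A.verts then k v else 1
    have hin : ∀ v ∈ A.verts, l v = k v := fun v hv => if_pos hv
    have hout : ∀ e ∉ A.edges, ∀ v, v = Λ.src e ∨ v = Λ.tgt e → l v = extend A g v := by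
      intro e he v hv
      by_cases hvA : v ∈ A.verts
      · have := Rectangle.mem_boundary_of_notMem_edges he hv hvA
        simp [l, hvA, extend, this, g, hk]
      · have : v ∉ A.boundary := fun h => hvA (Rectangle.boundary_subset_verts h)
        simp [l, hvA, extend, this]
    rw [← hψ.gauge_apply l (A.join a b)]
    congr 1
    funext e
    by_cases he : e ∈ A.edges
    · have := Rectangle.src_tgt_mem_verts e he
      simp [gauge, Rectangle.join, he, inGauge, hin _ this.1, hin _ this.2]
    · simp [gauge, Rectangle.join, he, f, outGauge, hout e he _ (Or.inl rfl),
        hout e he _ (Or.inr rfl)]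
  refine (Fintype.sum_equiv f _ _ fun b => ?_).symm
  rw [key h (fun _ _ => rfl), key h' (fun v hv => (hh v hv).symm)]

theorem IsGround.isFlat {ψ : Ket G Λ} (hψ : IsGround ψ) {x : Config G Λ} (hx : ψ x ≠ 0) :
    A.IsFlat x := by
  intro i hi j hj
  refine Rectangle.dartValue_mul_eq hi hj ?_
  by_contra hne
  refine hx ?_
  rw [← congrFun (hψ.2 (A.hor i j)) x]
  exact if_neg hne

variable {A} in
/-- The support of the reduced density matrix of a ground state. -/
theorem exists_of_reduced_ne_zero {ψ : Ket G Λ} (hψ : IsGround ψ) {a a' : A.InConfig G}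
    (haa' : reduced A ψ a a' ≠ 0) :
    ∃ h h' : Λ.V → G, a = inGauge A h 1 ∧ a' = inGauge A h' 1 ∧ ∀ v ∈ A.boundary, h v = h' v := by
  obtain ⟨b, -, hb⟩ := Finset.exists_ne_zero_of_sum_ne_zero haa'
  have hx := hψ.isFlat A (left_ne_zero_of_mul hb)
  have hx' := hψ.isFlat A (fun h0 => right_ne_zero_of_mul hb (by rw [h0, star_zero]))
  obtain ⟨h, hh⟩ := hx.exists_potential
  obtain ⟨h', hh'⟩ := hx'.exists_potential
  obtain ⟨hhor, hver⟩ := hx.boundary_eq hx' fun e he => by simp [Rectangle.join, he]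
  -- Where both configurations agree on an edge, `h'⁻¹ * h` takes the same value at its two ends.
  have hq : ∀ d : Λ.Dart, d.1 ∈ A.edges →
      dartValue Λ (A.join a b) d = dartValue Λ (A.join a' b) d →
      (h' (Λ.start d))⁻¹ * h (Λ.start d) = (h' (Λ.finish d))⁻¹ * h (Λ.finish d) := by
    intro d hd hdd
    rw [(dartValue_eq_iff d).mpr (hh d.1 hd), (dartValue_eq_iff d).mpr (hh' d.1 hd),
      mul_inv_eq_iff_eq_mul] at hdd
    rw [hdd]
    group
  have hconst := Rectangle.boundary_const (A := A) (q := fun v => (h' v)⁻¹ * h v)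
    (fun i h1 h2 j hj => by
      have := hq _ (Rectangle.hor_mem_edges h1 h2 (by omega) (by omega)) (hhor i h1 h2 j hj)
      rwa [A.hor_start _ (by omega) _ (by omega), A.hor_finish _ (by omega) _ (by omega)] at this)
    (fun j h1 h2 i hi => by
      have := hq _ (Rectangle.ver_mem_edges (by omega) (by omega) h1 h2) (hver j h1 h2 i hi)
      rwa [A.ver_start _ (by omega) _ (by omega), A.ver_finish _ (by omega) _ (by omega)] at this)
  -- Right multiplication of h' by the constant leaves its configuration unchanged and makes it
  -- agree with h on the boundary.
  refine ⟨h, h' * fun _ => (h' (A.vert 1 1))⁻¹ * h (A.vert 1 1), ?_, ?_, fun v hv => ?_⟩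
  · funext e
    simpa [Rectangle.join, inGauge] using hh e e.2
  · rw [inGauge_mul, inGauge_const]
    funext e
    simpa [Rectangle.join, inGauge] using hh' e e.2
  · rw [Pi.mul_apply, ← hconst v hv, mul_inv_cancel_left]

/-- Summation over the configurations of `A` which are gauge equivalent to the trivial one. -/
theorem card_mul_sum_eq_sum_inGauge (F : A.InConfig G → ℂ)
    (hF : ∀ a, F a ≠ 0 → ∃ h, a = inGauge A h 1) :
    ((Finset.univ.filter fun h : Λ.V → G => inGauge A h 1 = 1).card : ℂ) * ∑ a, F a =
      ∑ h, F (inGauge A h 1) := by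
  rw [← Finset.sum_fiberwise Finset.univ (fun h => inGauge A h 1), Finset.mul_sum]
  refine Finset.sum_congr rfl fun a _ => ?_
  rw [Finset.sum_congr rfl (g := fun _ => F a)
    (fun h hh => by rw [(Finset.mem_filter.mp hh).2]), Finset.sum_const, nsmul_eq_mul]
  by_cases ha : F a = 0
  · simp [ha]
  · obtain ⟨k, rfl⟩ := hF a ha
    refine congrArg (fun n : ℕ => (n : ℂ) * F (inGauge A k 1)) ?_
    -- The fibre over `inGauge A k 1` is the coset by k of the stabilizer of the trivial
    -- configuration.
    refine Finset.card_bij' (fun h _ => k * h) (fun h _ => k⁻¹ * h) ?_ ?_ ?_ ?_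
    · intro h hh
      simp only [Finset.mem_filter, Finset.mem_univ, true_and] at hh ⊢
      rw [inGauge_mul, hh]
    · intro h hh
      simp only [Finset.mem_filter, Finset.mem_univ, true_and] at hh ⊢
      rw [inGauge_mul, hh, ← inGauge_mul, inv_mul_cancel, inGauge_one]
    · simp
    · simp

/-- Restriction to the boundary vertices is onto, with fibres of equal size. -/
theorem card_pow_mul_sum_restrict (F : (A.boundary → G) → ℂ) :
    (Fintype.card G : ℂ) ^ Fintype.card A.boundary * ∑ h : Λ.V → G, F (fun v => h v) =
      (Fintype.card (Λ.V → G) : ℂ) * ∑ g, F g := by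
  let e := Equiv.piEquivPiSubtypeProd (fun v => v ∈ A.boundary) (fun _ : Λ.V => G)
  have h1 : ∑ h : Λ.V → G, F (fun v => h v) =
      ∑ p : (A.boundary → G) × ({v // v ∉ A.boundary} → G), F p.1 :=
    Fintype.sum_equiv e _ _ fun h => rfl
  have h2 : Fintype.card (Λ.V → G) =
      Fintype.card (A.boundary → G) * Fintype.card ({v // v ∉ A.boundary} → G) := by
    rw [← Fintype.card_prod]
    exact Fintype.card_congr e
  rw [h1, Fintype.sum_prod_type, h2]
  simp [← Finset.mul_sum]
  ring

theorem trace_reduced {ψ : Ket G Λ} (hψ : ∑ x, ‖ψ x‖ ^ 2 = 1) : (reduced A ψ).trace = 1 := by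
  let e : A.InConfig G × A.OutConfig G ≃ Config G Λ :=
    { toFun := fun p => A.join p.1 p.2
      invFun := fun x => (fun e => x e, fun e => x e)
      left_inv := fun p => by
        refine Prod.ext (funext fun e => ?_) (funext fun e => ?_)
        · exact dif_pos e.2
        · exact dif_neg e.2
      right_inv := fun x => funext fun e => by
        by_cases he : e ∈ A.edges
        · exact dif_pos he
        · exact dif_neg he }
  have h1 : ∑ p : A.InConfig G × A.OutConfig G, ψ (A.join p.1 p.2) * star (ψ (A.join p.1 p.2)) =
      ∑ x, ψ x * star (ψ x) :=
    Fintype.sum_equiv e _ _ fun p => rfl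
  rw [Fintype.sum_prod_type] at h1
  refine h1.trans ?_
  have h2 : ∀ x, ψ x * star (ψ x) = ((‖ψ x‖ ^ 2 : ℝ) : ℂ) := fun x => by
    rw [Complex.star_def, Complex.mul_conj, Complex.normSq_eq_norm_sq]
  simp only [h2]
  exact_mod_cast hψ

end InGauge

/-! ### Entries, square and twisted traces of the reduced density matrix -/

section Ground

variable {G : Type*} [Group G] [Fintype G] [DecidableEq G] {Λ : SurfaceLattice} (A : Rectangle Λ)
  {ψ : Ket G Λ}

/-- From the trivial configuration, ρ reaches a boundary transform only if g is constant. At most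
one term of the sum is nonzero; this form lets weights in g be summed directly. -/
theorem reduced_one_extend (hψ : IsGround ψ) (g : A.boundary → G) :
    reduced A ψ 1 (inGauge A (extend A g) 1) =
      ∑ x : G, if g = (fun _ => x) then reduced A ψ 1 1 else 0 := by
  have hu : A.boundary := ⟨_, Rectangle.corner_mem_boundary⟩
  by_cases hg : ∃ x, g = fun _ => x
  · obtain ⟨x, rfl⟩ := hg
    have hx : ∀ y : G, ((fun _ : A.boundary => x) = fun _ => y) ↔ x = y := fun y =>
      ⟨fun h => congrFun h hu, fun h => by rw [h]⟩
    simp only [hx, Finset.sum_ite_eq, Finset.mem_univ, if_true]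
    have := reduced_inGauge hψ.1 (A := A) (h := fun _ => x) (h' := extend A fun _ => x)
      (fun v hv => by simp [extend, hv]) 1 1
    rwa [inGauge_const] at this
  · rw [Finset.sum_eq_zero fun x _ => if_neg fun h => hg ⟨x, h⟩]
    by_contra hne
    obtain ⟨h, h', h1, h2, h3⟩ := exists_of_reduced_ne_zero hψ hne
    obtain ⟨x, hx⟩ := eq_const_of_inGauge_eq (k := 1) (h1.symm.trans (inGauge_one A 1).symm)
    obtain ⟨y, hy⟩ := eq_const_of_inGauge_eq h2
    refine hg ⟨x * y, funext fun v => ?_⟩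
    rw [← extend_apply A g v, hy v v.2, ← h3 v v.2, hx v v.2]
    simp

theorem sum_mul_reduced_one_extend (hψ : IsGround ψ) (φ : (A.boundary → G) → ℂ) :
    ∑ g, φ g * reduced A ψ 1 (inGauge A (extend A g) 1) =
      reduced A ψ 1 1 * ∑ x : G, φ fun _ => x := by
  simp only [reduced_one_extend A hψ, Finset.mul_sum]
  rw [Finset.sum_comm]
  refine Finset.sum_congr rfl fun x _ => ?_
  simp [mul_comm]

/-- The unit trace is spread evenly over the gauge orbit of the trivial configuration, whose size is
the order of the gauge group over that of the stabilizer. -/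
theorem card_mul_reduced_one_one (hψ : IsGround ψ) (hn : ∑ x, ‖ψ x‖ ^ 2 = 1) :
    (Fintype.card (Λ.V → G) : ℂ) * reduced A ψ 1 1 =
      (Finset.univ.filter fun h : Λ.V → G => inGauge A h 1 = 1).card := by
  have h := card_mul_sum_eq_sum_inGauge A (fun a => reduced A ψ a a) fun a ha => by
    obtain ⟨h, -, h1, -⟩ := exists_of_reduced_ne_zero hψ ha
    exact ⟨h, h1⟩
  have htr : ∑ a, reduced A ψ a a = 1 := trace_reduced A hn
  rw [htr, mul_one] at h
  rw [h, Finset.sum_congr rfl fun h _ => reduced_inGauge hψ.1 (h := h) (fun _ _ => rfl) 1 1,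
    Finset.sum_const, Finset.card_univ, nsmul_eq_mul]

/-- This row sum is the nonzero eigenvalue of ρ. An entry at `inGauge A h 1` depends only on h at
the boundary, and of the |G|^L boundary values just the |G| constants contribute. -/
theorem sum_reduced (hψ : IsGround ψ) (hn : ∑ x, ‖ψ x‖ ^ 2 = 1) :
    ∑ a, reduced A ψ 1 a = ((Fintype.card G : ℂ) ^ (Fintype.card A.boundary - 1))⁻¹ := by
  have hS := card_mul_reduced_one_one A hψ hn
  have h := card_mul_sum_eq_sum_inGauge A (fun a => reduced A ψ 1 a) fun a ha => by
    obtain ⟨-, h, -, h1, -⟩ := exists_of_reduced_ne_zero hψ ha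
    exact ⟨h, h1⟩
  have hdep : ∀ h : Λ.V → G, reduced A ψ 1 (inGauge A h 1) =
      reduced A ψ 1 (inGauge A (extend A fun v => h v) 1) := by
    intro h
    have := reduced_inGauge hψ.1 (A := A) (h := 1)
      (h' := (extend A fun v : A.boundary => h v) * h⁻¹)
      (fun v hv => by simp [extend, hv]) 1 (inGauge A h 1)
    rw [← this, ← inGauge_mul, inv_mul_cancel_right, inGauge_one]
  rw [Finset.sum_congr rfl fun h _ => hdep h] at h
  have hE := card_pow_mul_sum_restrict A fun g => reduced A ψ 1 (inGauge A (extend A g) 1)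
  have hsum := sum_mul_reduced_one_extend A hψ fun _ => 1
  simp only [one_mul, Finset.sum_const, Finset.card_univ, nsmul_eq_mul, mul_one] at hsum
  rw [← h, hsum, ← hS] at hE
  have hc : (Fintype.card G : ℂ) ≠ 0 := by simp
  have hS0 : (Fintype.card (Λ.V → G) : ℂ) * reduced A ψ 1 1 ≠ 0 := by
    rw [hS, Nat.cast_ne_zero]
    exact Finset.card_ne_zero_of_mem (a := 1) (by simp [inGauge_one])
  have hL := Rectangle.one_lt_card_boundary (A := A)
  obtain ⟨l, hl⟩ : ∃ l, Fintype.card A.boundary = l + 1 := ⟨_, (Nat.sub_add_cancel hL.le).symm⟩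
  rw [hl] at hE ⊢
  rw [Nat.add_sub_cancel]
  refine eq_inv_of_mul_eq_one_left (mul_left_cancel₀ (mul_ne_zero hc hS0) ?_)
  rw [pow_succ] at hE
  linear_combination hE

/-- The reduced density matrix of a ground state is a multiple of a projector. -/
theorem reduced_mul_self (hψ : IsGround ψ) (hn : ∑ x, ‖ψ x‖ ^ 2 = 1) :
    reduced A ψ * reduced A ψ =
      ((Fintype.card G : ℂ) ^ (Fintype.card A.boundary - 1))⁻¹ • reduced A ψ := by
  ext a a''
  rw [Matrix.mul_apply, Matrix.smul_apply, smul_eq_mul, ← sum_reduced A hψ hn, Finset.sum_mul]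
  by_cases ha : ∃ h, a = inGauge A h 1
  · obtain ⟨h, rfl⟩ := ha
    let e : A.InConfig G ≃ A.InConfig G :=
      { toFun := inGauge A h
        invFun := inGauge A h⁻¹
        left_inv := fun b => by rw [← inGauge_mul, inv_mul_cancel, inGauge_one]
        right_inv := fun b => by rw [← inGauge_mul, mul_inv_cancel, inGauge_one] }
    refine (Fintype.sum_equiv e _ _ fun a' => ?_).symm
    change _ = reduced A ψ (inGauge A h 1) (inGauge A h a') * reduced A ψ (inGauge A h a') a''
    rw [reduced_inGauge hψ.1 (fun _ _ => rfl)]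
    by_cases h0 : reduced A ψ 1 a' = 0
    · simp [h0]
    · obtain ⟨k, k', h1, h2, h3⟩ := exists_of_reduced_ne_zero hψ h0
      congr 1
      -- This element is 1 on the boundary and carries `inGauge A h 1` to `inGauge A h a'`, so the
      -- two rows of ρ coincide.
      have := reduced_inGauge hψ.1 (A := A) (h := h * k' * k⁻¹ * h⁻¹) (h' := 1)
        (fun v hv => by simp [h3 v hv]) (inGauge A h 1) a''
      rw [← this, inGauge_one]
      congr 1
      rw [h2]
      nth_rw 1 [h1]
      simp only [← inGauge_mul]
      congr 1
      group
  · have : ∀ a', reduced A ψ a a' = 0 := fun a' => by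
      by_contra hne
      obtain ⟨h, -, h1, -⟩ := exists_of_reduced_ne_zero hψ hne
      exact ha ⟨h, h1⟩
    simp [this]

/-- Moving the base point along the orbit conjugates g, which a class function does not see. Every
base point thus contributes as the trivial one does, where only constant g survive. -/
theorem sum_mul_trace_reduced_mul_bdryOp (hψ : IsGround ψ) (hn : ∑ x, ‖ψ x‖ ^ 2 = 1)
    (φ : (A.boundary → G) → ℂ) (hφ : ∀ g k, φ (k * g * k⁻¹) = φ g) :
    ∑ g, φ g * (reduced A ψ * bdryOp A g).trace = ∑ x : G, φ fun _ => x := by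
  have hS := card_mul_reduced_one_one A hψ hn
  have htr : ∀ g, (reduced A ψ * bdryOp A g).trace =
      ∑ a, reduced A ψ a (inGauge A (extend A g) a) := fun g => by
    refine Finset.sum_congr rfl fun a _ => ?_
    rw [Matrix.diag_apply, Matrix.mul_apply, Finset.sum_eq_single (inGauge A (extend A g) a)]
    · rw [bdryOp, bdryGauge_eq_inGauge, if_pos rfl, mul_one]
    · intro b _ hb
      rw [bdryOp, bdryGauge_eq_inGauge, if_neg hb, mul_zero]
    · simp
  have h := card_mul_sum_eq_sum_inGauge A
    (fun a => ∑ g, φ g * reduced A ψ a (inGauge A (extend A g) a)) fun a ha => by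
      obtain ⟨g, -, hg⟩ := Finset.exists_ne_zero_of_sum_ne_zero ha
      obtain ⟨h, -, h1, -⟩ := exists_of_reduced_ne_zero hψ (right_ne_zero_of_mul hg)
      exact ⟨h, h1⟩
  have hconj : ∀ h : Λ.V → G,
      ∑ g, φ g * reduced A ψ (inGauge A h 1) (inGauge A (extend A g) (inGauge A h 1)) =
        ∑ g, φ g * reduced A ψ 1 (inGauge A (extend A g) 1) := by
    intro h
    let k : A.boundary → G := fun v => h v
    refine (Fintype.sum_equiv (MulAut.conj k).toEquiv _ _ fun g => ?_).symm
    have hk : extend A (k * g * k⁻¹) = h * extend A g * h⁻¹ := extend_conj A h g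
    change _ = φ (k * g * k⁻¹) *
      reduced A ψ (inGauge A h 1) (inGauge A (extend A (k * g * k⁻¹)) (inGauge A h 1))
    rw [hφ, hk, ← inGauge_mul, inv_mul_cancel_right, inGauge_mul,
      reduced_inGauge hψ.1 (fun _ _ => rfl)]
  simp only [hconj, sum_mul_reduced_one_extend A hψ] at h
  rw [Finset.sum_const, Finset.card_univ, nsmul_eq_mul, ← mul_assoc, hS] at h
  have hS0 : ((Finset.univ.filter fun h : Λ.V → G => inGauge A h 1 = 1).card : ℂ) ≠ 0 := by
    rw [Nat.cast_ne_zero]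
    exact Finset.card_ne_zero_of_mem (a := 1) (by simp [inGauge_one])
  rw [← mul_left_cancel₀ hS0 h, Finset.sum_comm]
  simp only [htr, Finset.mul_sum]

end Ground

/-! ### Spectra of multiples of projectors -/

/-- Eigenvalues are 0 or μ, and on these two points `negMulLog` agrees with a linear function, so
the entropy is a multiple of the trace. -/
theorem vonNeumannEntropy_of_mul_self {W : Type*} [AddCommGroup W] [Module ℂ W]
    [Module.Finite ℂ W] {T : W →ₗ[ℂ] W} {μ : ℝ} (hμ : μ ≠ 0) (hT : T ∘ₗ T = (μ : ℂ) • T) :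
    vonNeumannEntropy T = Real.negMulLog μ / μ * (LinearMap.trace ℂ W T).re := by
  have hroots : ∀ z ∈ T.charpoly.roots, Real.negMulLog z.re = Real.negMulLog μ / μ * z.re := by
    intro z hz
    have hev : Module.End.HasEigenvalue T z := by
      rw [Module.End.hasEigenvalue_iff_isRoot_charpoly]
      exact Polynomial.isRoot_of_mem_roots hz
    obtain ⟨v, hv⟩ := hev.exists_hasEigenvector
    have h1 := LinearMap.congr_fun hT v
    simp only [LinearMap.comp_apply, LinearMap.smul_apply, hv.apply_eq_smul, map_smul,
      smul_smul] at h1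
    have h2 : z * z = μ * z := smul_left_injective ℂ hv.2 h1
    rcases mul_eq_mul_right_iff.mp h2 with rfl | rfl
    · simp [hμ]
    · simp
  rw [vonNeumannEntropy, Multiset.map_congr rfl hroots, Multiset.sum_map_mul_left,
    Module.End.trace_eq_sum_roots_charpoly_of_splits (IsAlgClosed.splits _)]
  congr 1
  exact (map_multiset_sum Complex.reAddGroupHom _).symm

theorem trace_mulLeft_mulRight {m n : Type*} [Fintype m] [Fintype n] [DecidableEq m]
    [DecidableEq n] (T : Matrix m n ℂ →ₗ[ℂ] Matrix m n ℂ) (X : Matrix m m ℂ) (Y : Matrix n n ℂ)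
    (hT : ∀ F, T F = X * F * Y) : LinearMap.trace ℂ _ T = X.trace * Y.trace := by
  rw [LinearMap.trace_eq_matrix_trace ℂ (Matrix.stdBasis ℂ m n), Matrix.trace, Matrix.trace,
    Matrix.trace, Finset.sum_mul_sum, Fintype.sum_prod_type]
  refine Finset.sum_congr rfl fun i _ => Finset.sum_congr rfl fun j _ => ?_
  rw [Matrix.diag_apply, LinearMap.toMatrix_apply, hT]
  simp [Matrix.stdBasis, Matrix.mul_apply]
  rw [Finset.sum_eq_single j (fun l _ hl => ?_) (by simp), Finset.sum_eq_single i
    (fun k _ hk => by simp [Pi.single_eq_of_ne hk]) (by simp)]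
  · simp
  · rw [Finset.sum_eq_zero fun k _ => ?_, zero_mul]
    by_cases hk : k = i
    · subst hk
      simp [Pi.single_eq_of_ne hl]
    · simp [Pi.single_eq_of_ne hk]

/-! ### Sectors -/

section Sectors

variable {G : Type*} [Group G] [Fintype G] [DecidableEq G] {Λ : SurfaceLattice} (A : Rectangle Λ)
  (Irr : Irreps G) (R : A.boundary → Irr.ι) {ψ : Ket G Λ}

theorem bdryOp_mul (g k : A.boundary → G) : bdryOp A (g * k) = bdryOp A g * bdryOp A k := by
  ext a c
  rw [Matrix.mul_apply, Finset.sum_eq_single (bdryGauge A k c)]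
  · simp only [bdryOp, if_true, mul_one, bdryGauge_eq_inGauge, extend_mul, inGauge_mul]
    congr
  · intro b _ hb
    rw [bdryOp, bdryOp, if_neg hb, mul_zero]
  · simp

/-- The projection onto the multiplicity space of `R`, by averaging over the boundary gauge
transformations. -/
def averaging : Matrix (A.InConfig G) (TensorIndex A Irr R) ℂ →ₗ[ℂ]
    Matrix (A.InConfig G) (TensorIndex A Irr R) ℂ where
  toFun F := (Fintype.card (A.boundary → G) : ℂ)⁻¹ •
    ∑ g : A.boundary → G, bdryOp A g * F * tensorD A Irr R g⁻¹
  map_add' F F' := by simp only [Matrix.mul_add, Matrix.add_mul, Finset.sum_add_distrib, smul_add]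
  map_smul' c F := by
    simp only [Matrix.mul_smul, Matrix.smul_mul, ← Finset.smul_sum, RingHom.id_apply]
    rw [smul_comm]

theorem averaging_apply (F : Matrix (A.InConfig G) (TensorIndex A Irr R) ℂ) :
    averaging A Irr R F = (Fintype.card (A.boundary → G) : ℂ)⁻¹ •
      ∑ g : A.boundary → G, bdryOp A g * F * tensorD A Irr R g⁻¹ := rfl

theorem averaging_mem (F : Matrix (A.InConfig G) (TensorIndex A Irr R) ℂ) :
    averaging A Irr R F ∈ multiplicity A Irr R := by
  intro k
  rw [averaging_apply, Matrix.mul_smul, Matrix.smul_mul, Matrix.mul_sum, Matrix.sum_mul]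
  refine congrArg _ (Fintype.sum_equiv (Equiv.mulLeft k) _ _ fun g => ?_)
  simp only [Equiv.coe_mulLeft, bdryOp_mul, Matrix.mul_assoc, ← tensorD_mul, mul_inv_rev,
    inv_mul_cancel_right]

theorem averaging_eq {F : Matrix (A.InConfig G) (TensorIndex A Irr R) ℂ}
    (hF : F ∈ multiplicity A Irr R) : averaging A Irr R F = F := by
  have h : ∀ g, bdryOp A g * F * tensorD A Irr R g⁻¹ = F := fun g => by
    rw [hF g, Matrix.mul_assoc, ← tensorD_mul, mul_inv_cancel, tensorD_one, Matrix.mul_one]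
  have hc : (Fintype.card (A.boundary → G) : ℂ) ≠ 0 := Nat.cast_ne_zero.mpr Fintype.card_ne_zero
  rw [averaging_apply, Finset.sum_congr rfl fun g _ => h g, Finset.sum_const, Finset.card_univ,
    ← Nat.cast_smul_eq_nsmul ℂ, smul_smul, inv_mul_cancel₀ hc, one_smul]

/-- Extended by the averaging projection, the operator becomes an average of maps F ↦ ρ g F D(g⁻¹),
each with trace tr(ρ g) tr D(g⁻¹). Characters are class functions, so only constant g remain, and
they count singlets. -/
theorem trace_sectorOp (hψ : IsGround ψ) (hn : ∑ x, ‖ψ x‖ ^ 2 = 1) :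
    LinearMap.trace ℂ _ (sectorOp A Irr R hψ.1) =
      ((Fintype.card G : ℂ) ^ (Fintype.card A.boundary - 1))⁻¹ * numSinglets A Irr R := by
  let p : Matrix (A.InConfig G) (TensorIndex A Irr R) ℂ →ₗ[ℂ] multiplicity A Irr R :=
    (averaging A Irr R).codRestrict _ (averaging_mem A Irr R)
  let ι := (multiplicity A Irr R).subtype
  let T := mulLeftLinearMap (TensorIndex A Irr R) ℂ (reduced A ψ)
  have hp : p ∘ₗ ι = LinearMap.id := LinearMap.ext fun F => Subtype.ext (averaging_eq A Irr R F.2)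
  have h1 : LinearMap.trace ℂ _ (sectorOp A Irr R hψ.1) =
      LinearMap.trace ℂ _ (T ∘ₗ averaging A Irr R) := by
    have h2 : T ∘ₗ averaging A Irr R = ι ∘ₗ (sectorOp A Irr R hψ.1 ∘ₗ p) := rfl
    rw [h2, LinearMap.trace_comp_comm', LinearMap.comp_assoc, hp, LinearMap.comp_id]
  let S : (A.boundary → G) → Matrix (A.InConfig G) (TensorIndex A Irr R) ℂ →ₗ[ℂ]
      Matrix (A.InConfig G) (TensorIndex A Irr R) ℂ := fun g =>
    { toFun := fun F => (reduced A ψ * bdryOp A g) * F * tensorD A Irr R g⁻¹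
      map_add' := fun F F' => by simp only [Matrix.mul_add, Matrix.add_mul]
      map_smul' := fun c F => by simp only [Matrix.mul_smul, Matrix.smul_mul, RingHom.id_apply] }
  have h3 : T ∘ₗ averaging A Irr R = (Fintype.card (A.boundary → G) : ℂ)⁻¹ • ∑ g, S g := by
    refine LinearMap.ext fun F => ?_
    rw [LinearMap.comp_apply, averaging_apply, mulLeftLinearMap_apply, LinearMap.smul_apply, LinearMap.sum_apply, Matrix.mul_smul, Matrix.mul_sum]
    simp only [S, LinearMap.coe_mk, AddHom.coe_mk, Matrix.mul_assoc]
  rw [h1, h3, map_smul, map_sum, Finset.sum_congr rfl fun g _ =>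
    (trace_mulLeft_mulRight (S g) _ _ fun _ => rfl).trans (mul_comm _ _),
    sum_mul_trace_reduced_mul_bdryOp A hψ hn fun g => (tensorD A Irr R g⁻¹).trace]
  · have h4 : ∑ x : G, (tensorD A Irr R (fun _ => x)⁻¹).trace =
        (Fintype.card G : ℂ) * numSinglets A Irr R := by
      rw [card_mul_numSinglets]
      refine Fintype.sum_equiv (Equiv.inv G) _ _ fun x => ?_
      rw [trace_tensorD]
      rfl
    rw [h4, smul_eq_mul, Fintype.card_fun, Nat.cast_pow]
    have hc : (Fintype.card G : ℂ) ≠ 0 := by simp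
    have hL := Rectangle.one_lt_card_boundary (A := A)
    obtain ⟨l, hl⟩ : ∃ l, Fintype.card A.boundary = l + 1 := ⟨_, (Nat.sub_add_cancel hL.le).symm⟩
    rw [hl, Nat.add_sub_cancel]
    field_simp
    ring
  · intro g k
    simp only [trace_tensorD]
    refine Finset.prod_congr rfl fun v _ => ?_
    have : (k * g * k⁻¹)⁻¹ v = k v * g⁻¹ v * (k v)⁻¹ := by simp [mul_assoc]
    rw [this]
    exact Representation.char_conj _ _ _

theorem sectorOp_comp_self (hψ : IsGround ψ) (hn : ∑ x, ‖ψ x‖ ^ 2 = 1) :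
    sectorOp A Irr R hψ.1 ∘ₗ sectorOp A Irr R hψ.1 =
      ((Fintype.card G : ℂ) ^ (Fintype.card A.boundary - 1))⁻¹ • sectorOp A Irr R hψ.1 := by
  refine LinearMap.ext fun F => Subtype.ext ?_
  change reduced A ψ * (reduced A ψ * F.1) =
    ((Fintype.card G : ℂ) ^ (Fintype.card A.boundary - 1))⁻¹ • (reduced A ψ * F.1)
  rw [← Matrix.mul_assoc, reduced_mul_self A hψ hn, Matrix.smul_mul]

theorem sectorProb_eq (hψ : IsGround ψ) (hn : ∑ x, ‖ψ x‖ ^ 2 = 1) :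
    sectorProb A Irr R hψ.1 = ((Fintype.card G : ℝ) ^ (Fintype.card A.boundary - 1))⁻¹ *
      (numSinglets A Irr R * tensorDim A Irr R) := by
  have hid : (LinearMap.lTensor (TensorIndex A Irr R → ℂ) (sectorOp A Irr R hψ.1)) =
      TensorProduct.map LinearMap.id (sectorOp A Irr R hψ.1) := rfl
  have hdim : (Module.finrank ℂ (TensorIndex A Irr R → ℂ)) = tensorDim A Irr R := by
    simp [tensorDim, TensorIndex]
  rw [sectorProb, hid, LinearMap.trace_tensorProduct', LinearMap.trace_id, hdim,
    trace_sectorOp A Irr R hψ hn]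
  have : (tensorDim A Irr R : ℂ) * (((Fintype.card G : ℂ) ^ (Fintype.card A.boundary - 1))⁻¹ *
      numSinglets A Irr R) = ((((Fintype.card G : ℝ) ^ (Fintype.card A.boundary - 1))⁻¹ *
      (numSinglets A Irr R * tensorDim A Irr R) : ℝ) : ℂ) := by
    push_cast
    ring
  rw [this, Complex.ofReal_re]

theorem tensorDim_pos : 0 < tensorDim A Irr R := Finset.prod_pos fun v _ => Irr.one_le_dim (R v)

/-- The state has trace 1 and its only nonzero eigenvalue is 1/N_R. -/
theorem vonNeumannEntropy_sectorState (hψ : IsGround ψ) (hn : ∑ x, ‖ψ x‖ ^ 2 = 1)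
    (hN : numSinglets A Irr R ≠ 0) :
    vonNeumannEntropy (sectorState A Irr R hψ.1) = Real.log (numSinglets A Irr R) := by
  have hNC : (numSinglets A Irr R : ℂ) ≠ 0 := by exact_mod_cast hN
  have hNR : (numSinglets A Irr R : ℝ) ≠ 0 := by exact_mod_cast hN
  have hd : (tensorDim A Irr R : ℂ) ≠ 0 := by exact_mod_cast (tensorDim_pos A Irr R).ne'
  have hp : (Fintype.card G : ℂ) ^ (Fintype.card A.boundary - 1) ≠ 0 := pow_ne_zero _ (by simp)
  have hst : sectorState A Irr R hψ.1 = ((Fintype.card G : ℂ) ^ (Fintype.card A.boundary - 1) /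
      numSinglets A Irr R) • sectorOp A Irr R hψ.1 := by
    rw [sectorState, sectorProb_eq A Irr R hψ hn]
    congr 1
    push_cast
    field_simp
  have htr : (Fintype.card G : ℂ) ^ (Fintype.card A.boundary - 1) / numSinglets A Irr R *
      (((Fintype.card G : ℂ) ^ (Fintype.card A.boundary - 1))⁻¹ * numSinglets A Irr R) = 1 := by
    field_simp
  rw [vonNeumannEntropy_of_mul_self (inv_ne_zero hNR), hst, map_smul,
    trace_sectorOp A Irr R hψ hn, smul_eq_mul, htr]
  · rw [Real.negMulLog, Real.log_inv, Complex.one_re]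
    field_simp
  · rw [hst, LinearMap.comp_smul, LinearMap.smul_comp, sectorOp_comp_self A Irr R hψ hn,
      smul_smul, smul_smul, smul_smul]
    congr 1
    push_cast
    field_simp

theorem extendedEntropy_eq (hψ : IsGround ψ) (hn : ∑ x, ‖ψ x‖ ^ 2 = 1) :
    extendedEntropy A ψ = ((A.len : ℝ) - 1) * Real.log (Fintype.card G) := by
  have hp : (Fintype.card G : ℝ) ^ (Fintype.card A.boundary - 1) ≠ 0 := pow_ne_zero _ (by simp)
  rw [extendedEntropy, vonNeumannEntropy_of_mul_self (inv_ne_zero hp), Matrix.trace_toLin'_eq,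
    trace_reduced A hn]
  · have hL := Rectangle.one_lt_card_boundary (A := A)
    rw [Real.negMulLog, Real.log_inv, Real.log_pow, Nat.cast_sub hL.le, Fintype.card_coe]
    field_simp
    simp [Rectangle.len, mul_comm]
  · rw [← Matrix.toLin'_mul, reduced_mul_self A hψ hn, map_smul]
    push_cast
    rfl

theorem distillableEntropy_eq (hψ : IsGround ψ) (hn : ∑ x, ‖ψ x‖ ^ 2 = 1) :
    distillableEntropy A Irr hψ.1 = 1 / (Fintype.card G : ℝ) ^ (A.len - 1) *
      ∑ R : A.boundary → Irr.ι, (numSinglets A Irr R : ℝ) * (tensorDim A Irr R : ℝ) *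
        Real.log (numSinglets A Irr R) := by
  rw [distillableEntropy, Finset.mul_sum]
  refine Finset.sum_congr rfl fun R _ => ?_
  rw [sectorProb_eq A Irr R hψ hn, Fintype.card_coe, Rectangle.len, one_div]
  by_cases hN : numSinglets A Irr R = 0
  · simp [hN]
  · rw [vonNeumannEntropy_sectorState A Irr R hψ hn hN]
    ring

/-- The marginal of the label at any one boundary vertex is the Plancherel measure. -/
theorem sum_sectorProb_mul (hψ : IsGround ψ) (hn : ∑ x, ‖ψ x‖ ^ 2 = 1) (u : A.boundary)
    (w : Irr.ι → ℝ) : ∑ R, sectorProb A Irr R hψ.1 * w (R u) =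
      (Fintype.card G : ℝ)⁻¹ * ∑ r, (Irr.dim r : ℝ) ^ 2 * w r := by
  have hL := Rectangle.one_lt_card_boundary (A := A)
  have h := sum_numSinglets_mul_tensorDim_mul A Irr hL u w
  obtain ⟨l, hl⟩ : ∃ l, Fintype.card A.boundary = l + 2 := ⟨_, (Nat.sub_add_cancel hL).symm⟩
  have hc : (Fintype.card G : ℝ) ≠ 0 := by simp
  simp only [sectorProb_eq A Irr _ hψ hn, mul_assoc, ← Finset.mul_sum]
  simp only [mul_assoc] at h
  rw [h, hl, Nat.add_sub_cancel, show l + 2 - 1 = l + 1 by omega, pow_succ, mul_inv]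
  field_simp

theorem sum_sectorProb (hψ : IsGround ψ) (hn : ∑ x, ‖ψ x‖ ^ 2 = 1) :
    ∑ R, sectorProb A Irr R hψ.1 = 1 := by
  have h := sum_sectorProb_mul A Irr hψ hn ⟨_, Rectangle.corner_mem_boundary⟩ fun _ => 1
  simp only [mul_one, Irr.sum_dim_sq] at h
  rw [h, inv_mul_cancel₀ (by simp)]

theorem logDimTerm_eq (hψ : IsGround ψ) (hn : ∑ x, ‖ψ x‖ ^ 2 = 1) :
    logDimTerm A Irr hψ.1 = (A.len : ℝ) / (Fintype.card G : ℝ) *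
      ∑ R : Irr.ι, (Irr.dim R : ℝ) ^ 2 * Real.log (Irr.dim R) := by
  simp only [logDimTerm, Finset.mul_sum (Finset.univ : Finset A.boundary)]
  rw [Finset.sum_comm]
  rw [Finset.sum_congr rfl fun v _ =>
    sum_sectorProb_mul A Irr hψ hn v fun r => Real.log (Irr.dim r)]
  rw [Finset.sum_const, Finset.card_univ, Fintype.card_coe, nsmul_eq_mul, Rectangle.len]
  ring

/-- The logarithm of p_R splits into the three contributions; sectors without singlets have p_R = 0
and drop out. -/
theorem classicalTerm_eq (hψ : IsGround ψ) (hn : ∑ x, ‖ψ x‖ ^ 2 = 1) :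
    classicalTerm A Irr hψ.1 = ((A.len : ℝ) - 1) * Real.log (Fintype.card G) -
      logDimTerm A Irr hψ.1 - distillableEntropy A Irr hψ.1 := by
  have hL := Rectangle.one_lt_card_boundary (A := A)
  have hterm : ∀ R, Real.negMulLog (sectorProb A Irr R hψ.1) =
      sectorProb A Irr R hψ.1 * (((A.len : ℝ) - 1) * Real.log (Fintype.card G)) -
      sectorProb A Irr R hψ.1 * ∑ v : A.boundary, Real.log (Irr.dim (R v)) -
      sectorProb A Irr R hψ.1 * vonNeumannEntropy (sectorState A Irr R hψ.1) := by
    intro R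
    by_cases hN : numSinglets A Irr R = 0
    · simp [sectorProb_eq A Irr R hψ hn, hN]
    · have hNR : (numSinglets A Irr R : ℝ) ≠ 0 := by exact_mod_cast hN
      have hd : (tensorDim A Irr R : ℝ) ≠ 0 := by exact_mod_cast (tensorDim_pos A Irr R).ne'
      have hp : (Fintype.card G : ℝ) ^ (Fintype.card A.boundary - 1) ≠ 0 :=
        pow_ne_zero _ (by simp)
      have hlog : Real.log (tensorDim A Irr R) = ∑ v : A.boundary, Real.log (Irr.dim (R v)) := by
        rw [tensorDim, Nat.cast_prod, Real.log_prod fun v _ => ?_]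
        exact_mod_cast Nat.one_le_iff_ne_zero.mp (Irr.one_le_dim (R v))
      rw [vonNeumannEntropy_sectorState A Irr R hψ hn hN, ← hlog, Real.negMulLog]
      have hlogp : Real.log (sectorProb A Irr R hψ.1) =
          -(((A.len : ℝ) - 1) * Real.log (Fintype.card G)) + (Real.log (numSinglets A Irr R) +
            Real.log (tensorDim A Irr R)) := by
        rw [sectorProb_eq A Irr R hψ hn, Real.log_mul (inv_ne_zero hp) (mul_ne_zero hNR hd),
          Real.log_mul hNR hd, Real.log_inv, Real.log_pow, Nat.cast_sub hL.le, Fintype.card_coe,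
          Nat.cast_one, Rectangle.len]
      rw [hlogp]
      ring
  rw [classicalTerm, Finset.sum_congr rfl fun R _ => hterm R, Finset.sum_sub_distrib,
    Finset.sum_sub_distrib, ← Finset.sum_mul, sum_sectorProb A Irr hψ hn, one_mul]
  rfl

theorem algebraicEntropy_eq (hψ : IsGround ψ) (hn : ∑ x, ‖ψ x‖ ^ 2 = 1) :
    algebraicEntropy A Irr hψ.1 = (A.len : ℝ) * (Real.log (Fintype.card G) -
      1 / (Fintype.card G : ℝ) * ∑ R : Irr.ι, (Irr.dim R : ℝ) ^ 2 * Real.log (Irr.dim R)) -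
      Real.log (Fintype.card G) := by
  rw [algebraicEntropy, classicalTerm_eq A Irr hψ hn, logDimTerm_eq A Irr hψ hn]
  ring

theorem distillableEntropy_eq_zero (hG : ∀ a b : G, a * b = b * a) (hψ : IsGround ψ)
    (hn : ∑ x, ‖ψ x‖ ^ 2 = 1) : distillableEntropy A Irr hψ.1 = 0 := by
  rw [distillableEntropy_eq A Irr hψ hn, Finset.sum_eq_zero, mul_zero]
  intro R _
  have h : numSinglets A Irr R ≤ 1 := by
    simpa [tensorDim, Irr.dim_eq_one hG] using numSinglets_le A Irr R
  interval_cases numSinglets A Irr R <;> simp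

end Sectors

/-! ### Asymptotics -/

/-- For two affine fits, (α - α') L converges; since L → ∞ the slopes agree, and then so do the
constants. -/
theorem isTopologicalEntropy_iff {L : ℕ → ℕ} (hL : Tendsto L atTop atTop) {S : ℕ → ℝ} {α γ : ℝ}
    (hα : 0 ≤ α) (hγ : 0 ≤ γ) (hS : ∀ k, S k = α * L k - γ) (s : ℝ) :
    IsTopologicalEntropy L S s ↔ s = -γ := by
  constructor
  · rintro ⟨α', γ', -, -, rfl, h⟩
    have hLR : Tendsto (fun k => (L k : ℝ)) atTop atTop := tendsto_natCast_atTop_atTop.comp hL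
    have h1 : Tendsto (fun k => (α - α') * (L k : ℝ)) atTop (𝓝 (γ - γ')) := by
      have := h.add_const (γ - γ')
      rw [zero_add] at this
      refine this.congr fun k => ?_
      rw [hS]
      ring
    have h2 : Tendsto (fun k => (α - α') * (L k : ℝ) * (L k : ℝ)⁻¹) atTop (𝓝 0) := by
      simpa using h1.mul (tendsto_inv_atTop_zero.comp hLR)
    have h3 : Tendsto (fun k => (α - α') * (L k : ℝ) * (L k : ℝ)⁻¹) atTop (𝓝 (α - α')) := by
      refine tendsto_const_nhds.congr' ?_
      filter_upwards [hLR.eventually_ne_atTop 0] with k hk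
      rw [mul_inv_cancel_right₀ hk]
    have h4 : α - α' = 0 := tendsto_nhds_unique h3 h2
    simp only [h4, zero_mul] at h1
    have h5 := tendsto_nhds_unique h1 tendsto_const_nhds
    linarith
  · rintro rfl
    exact ⟨α, γ, hα, hγ, rfl, by simp [hS]⟩

/-- Makes the slope of the algebraic entropy nonnegative, as the definition of topological entropy
demands. -/
theorem Irreps.logDim_average_le {G : Type*} [Group G] [Fintype G] (Irr : Irreps G) :
    1 / (Fintype.card G : ℝ) * ∑ R : Irr.ι, (Irr.dim R : ℝ) ^ 2 * Real.log (Irr.dim R) ≤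
      Real.log (Fintype.card G) := by
  classical
  have hc : (0 : ℝ) < Fintype.card G := by exact_mod_cast Fintype.card_pos
  rw [one_div, inv_mul_le_iff₀ hc]
  calc ∑ R : Irr.ι, (Irr.dim R : ℝ) ^ 2 * Real.log (Irr.dim R)
      ≤ ∑ R : Irr.ι, (Irr.dim R : ℝ) ^ 2 * Real.log (Fintype.card G) :=
        Finset.sum_le_sum fun R _ => mul_le_mul_of_nonneg_left (Irr.log_dim_le R) (by positivity)
    _ = _ := by rw [← Finset.sum_mul, Irr.sum_dim_sq]

end QuantumDouble

end

/-! ### The main theorem -/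

theorem mainTheorem4 {G : Type*} [Group G] [Fintype G] [DecidableEq G]
    (Irr : QuantumDouble.Irreps G) :
    (∀ X : QuantumDouble.GroundData G,
      QuantumDouble.extendedEntropy X.region X.ψ
          = ((X.region.len : ℝ) - 1) * Real.log (Fintype.card G) ∧
      QuantumDouble.logDimTerm X.region Irr X.ground.1
          = (X.region.len : ℝ) / (Fintype.card G : ℝ) *
              ∑ R : Irr.ι, (Irr.dim R : ℝ) ^ 2 * Real.log (Irr.dim R) ∧
      QuantumDouble.algebraicEntropy X.region Irr X.ground.1
          = (X.region.len : ℝ) * (Real.log (Fintype.card G) - 1 / (Fintype.card G : ℝ) *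
              ∑ R : Irr.ι, (Irr.dim R : ℝ) ^ 2 * Real.log (Irr.dim R))
            - Real.log (Fintype.card G) ∧
      QuantumDouble.distillableEntropy X.region Irr X.ground.1
          = 1 / (Fintype.card G : ℝ) ^ (X.region.len - 1) *
              ∑ R : X.region.boundary → Irr.ι,
                (QuantumDouble.numSinglets X.region Irr R : ℝ) *
                  (QuantumDouble.tensorDim X.region Irr R : ℝ) *
                  Real.log (QuantumDouble.numSinglets X.region Irr R) ∧
      ((∀ a b : G, a * b = b * a) →
        QuantumDouble.distillableEntropy X.region Irr X.ground.1 = 0)) ∧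
    (∀ X : ℕ → QuantumDouble.GroundData G,
      Filter.Tendsto (fun k => (X k).region.len) Filter.atTop Filter.atTop →
      (∀ s : ℝ, QuantumDouble.IsTopologicalEntropy (fun k => (X k).region.len)
          (fun k => QuantumDouble.extendedEntropy (X k).region (X k).ψ) s
            ↔ s = -Real.log (Fintype.card G)) ∧
      (∀ s : ℝ, QuantumDouble.IsTopologicalEntropy (fun k => (X k).region.len)
          (fun k => QuantumDouble.algebraicEntropy (X k).region Irr (X k).ground.1) s
            ↔ s = -Real.log (Fintype.card G)) ∧
      ((∀ a b : G, a * b = b * a) →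
        ∀ s : ℝ, QuantumDouble.IsTopologicalEntropy (fun k => (X k).region.len)
          (fun k => QuantumDouble.distillableEntropy (X k).region Irr (X k).ground.1) s
            ↔ s = 0) ∧
      ((∀ a b : G, a * b = b * a) → Nontrivial G →
        ¬ QuantumDouble.IsTopologicalEntropy (fun k => (X k).region.len)
          (fun k => QuantumDouble.distillableEntropy (X k).region Irr (X k).ground.1)
          (-Real.log (Fintype.card G)))) := by
  have hlog : 0 ≤ Real.log (Fintype.card G) := Real.log_natCast_nonneg _
  refine ⟨fun X => ⟨?_, ?_, ?_, ?_, fun hG => ?_⟩, fun X hX => ⟨?_, ?_, ?_, fun hG hG' => ?_⟩⟩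
  · exact QuantumDouble.extendedEntropy_eq X.region X.ground X.normalized
  · exact QuantumDouble.logDimTerm_eq X.region Irr X.ground X.normalized
  · exact QuantumDouble.algebraicEntropy_eq X.region Irr X.ground X.normalized
  · exact QuantumDouble.distillableEntropy_eq X.region Irr X.ground X.normalized
  · exact QuantumDouble.distillableEntropy_eq_zero X.region Irr hG X.ground X.normalized
  · refine QuantumDouble.isTopologicalEntropy_iff hX hlog hlog fun k => ?_
    rw [QuantumDouble.extendedEntropy_eq (X k).region (X k).ground (X k).normalized]
    ring
  · refine QuantumDouble.isTopologicalEntropy_iff hX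
      (sub_nonneg.mpr Irr.logDim_average_le) hlog fun k => ?_
    rw [QuantumDouble.algebraicEntropy_eq (X k).region Irr (X k).ground (X k).normalized]
    ring
  · intro hG s
    rw [QuantumDouble.isTopologicalEntropy_iff hX le_rfl le_rfl fun k => ?_, neg_zero]
    rw [QuantumDouble.distillableEntropy_eq_zero (X k).region Irr hG (X k).ground
      (X k).normalized]
    ring
  · rw [QuantumDouble.isTopologicalEntropy_iff hX le_rfl le_rfl fun k => ?_]
    · have : 0 < Real.log (Fintype.card G) :=
        Real.log_pos (by exact_mod_cast Fintype.one_lt_card)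
      intro h
      linarith
    · rw [QuantumDouble.distillableEntropy_eq_zero (X k).region Irr hG (X k).ground
        (X k).normalized]
      ring
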